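/- Let $m$ be a positive integer, $\tau,z\in\mathbb C$ with $\operatorname{Im}\tau>0$, and $q=e^{2\pi i\tau}$. For $m\in\frac12\mathbb N$, $s\in\frac12\mathbb Z$ put $$\Phi_1^{[m,s]}(\tau,z_1,z_2,t)=e^{-2\pi imt}\sum_{j\in\mathbb Z}\frac{e^{2\pi imj(z_1+z_2)+2\pi isz_1}q^{mj^2+sj}}{1-e^{2\pi iz_1}q^j},$$ $$\Phi_2^{[m,s]}(\tau,z_1,z_2,t)=e^{-2\pi imt}\sum_{j\in\mathbb Z}\frac{e^{-2\pi imj(z_1+z_2)-2\pi isz_2}q^{mj^2+sj}}{1-e^{-2\pi iz_2}q^j},$$ $\Phi^{[m,s]}=\Phi_1^{[m,s]}-\Phi_2^{[m,s]}$, and $\widetilde\Phi^{[m,s]}=\Phi^{[m,s]}+\Phi^{[m,s]}_{\rm add}$, where $$\Phi^{[m,s]}_{\rm add}(\tau,z_1,z_2,t)=-\tfrac12e^{-2\pi imt}\sum_{k\in s+\mathbb Z,\ s\le k<s+2m}R_{k;m}\Big(\tau,\frac{z_1-z_2}2\Big)\big[\theta_{k,m}-\theta_{-k,m}\big](\tau,z_1+z_2),$$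 $$R_{j;m}(\tau,w)=\sum_{n\equiv j\bmod 2m}\Big\{\operatorname{sgn}\big(n-\tfrac12-j+2m\big)-E\Big(\big(n-2m\tfrac{\operatorname{Im}w}{\operatorname{Im}\tau}\big)\sqrt{\tfrac{\operatorname{Im}\tau}m}\Big)\Big\}e^{-\frac{\pi in^2\tau}{2m}+2\pi inw},$$ $E(x)=2\int_0^xe^{-\pi t^2}dt$ and $\theta_{k,m}(\tau,z)=\sum_{j\in\mathbb Z}e^{2\pi im(j+\frac k{2m})z}q^{m(j+\frac k{2m})^2}$. For $1\le j\le 6$ let $$c_1=\tfrac\tau4+\tfrac14,\quad c_2=\tfrac\tau4-\tfrac14,\quad c_3=\tfrac\tau4+\tfrac12,\quad c_4=\tfrac\tau4,\quad c_5=\tfrac14,\quad c_6=\tfrac\tau2-\tfrac14,$$ $\widetilde A^{[m]}_j(\tau,z)=\widetilde\Phi^{[m,0]}\big(\tau,\tfrac z2+c_j,\tfrac z2-c_j,0\big)$, and $$\overset{\circ}{A}{}^{[m]}_j=e^{-\frac{\pi im\tau}8}\widetilde A^{[m]}_j\ (1\le j\le4),\qquad \overset{\circ}{A}{}^{[m]}_5=\widetilde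 A^{[m]}_5,\qquad \overset{\circ}{A}{}^{[m]}_6=e^{-\frac{\pi im\tau}2}\widetilde A^{[m]}_6 .$$ A pair $(\tau,z)$ is a pole of $\overset{\circ}{A}{}^{[m]}_j$ if $\frac z2+c_j$ or $\frac z2-c_j$ lies in $\mathbb Z+\mathbb Z\tau$. Then each of the following identities holds whenever $(\tau,z)$ is not a pole of either of the two functions on its right-hand side: $$2\overset{\circ}{A}{}^{[m]}_3(2\tau,2z)=\overset{\circ}{A}{}^{[2m]}_1(\tau,z)+\overset{\circ}{A}{}^{[2m]}_2(\tau,z),$$ $$\overset{\circ}{A}{}^{[m]}_6\Big(\frac\tau2,z\Big)=e^{-\pi im}\overset{\circ}{A}{}^{[2m]}_1(\tau,z)+\overset{\circ}{A}{}^{[2m]}_2(\tau,z),$$ $$2\overset{\circ}{A}{}^{[m]}_4(2\tau,2z)=\overset{\circ}{A}{}^{[2m]}_3(\tau,z)+\overset{\circ}{A}{}^{[2m]}_4(\tau,z),$$ $$e^{\frac{\pi im}4}\overset{\circ}{A}{}^{[m]}_6\Big(\frac{\tau+1}2,z\Big)=e^{-\pi im}\overset{\circ}{A}{}^{[2m]}_3(\tau,z)+\overset{\circ}{A}{}^{[2m]}_4(\tau,z),$$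 $$\overset{\circ}{A}{}^{[m]}_5\Big(\frac\tau2,z\Big)=\overset{\circ}{A}{}^{[2m]}_5(\tau,z)+e^{\pi im}\overset{\circ}{A}{}^{[2m]}_6(\tau,z),$$ $$\overset{\circ}{A}{}^{[m]}_6\Big(-\frac1{2\tau}+\frac12,\frac z\tau\Big)=\tau\,e^{-\frac{\pi im}4}e^{\frac{\pi imz^2}\tau}\Big\{\overset{\circ}{A}{}^{[2m]}_5(\tau,z)+\overset{\circ}{A}{}^{[2m]}_6(\tau,z)\Big\}.$$ -/

import Mathlib

noncomputable section

namespace MockTheta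

open Complex

/-- `E(x) = 2 ∫₀ˣ e^{-π t²} dt` for real `x`. -/
def errE (x : ℝ) : ℝ := 2 * ∫ t in (0 : ℝ)..x, Real.exp (-Real.pi * t ^ 2)

/-- The Jacobi theta function
`θ_{k,m}(τ, z) = ∑_{j ∈ ℤ} e^{2πim(j + k/2m)z} q^{m(j + k/2m)²}`, with `q = e^{2πiτ}`. -/
def jacobiTheta (k m : ℝ) (τ z : ℂ) : ℂ :=
  ∑' j : ℤ,
    exp (2 * Real.pi * I * m * ((j : ℂ) + k / (2 * m)) * z) *
      exp (2 * Real.pi * I * τ * (m * ((j : ℂ) + k / (2 * m)) ^ 2))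

/-- `Φ₁^{[m,s]}(τ, z₁, z₂, t)`. -/
def Phi1 (m s : ℝ) (τ z₁ z₂ t : ℂ) : ℂ :=
  exp (-(2 * Real.pi * I * m * t)) *
    ∑' j : ℤ,
      exp (2 * Real.pi * I * m * j * (z₁ + z₂) + 2 * Real.pi * I * s * z₁) *
          exp (2 * Real.pi * I * τ * (m * (j : ℂ) ^ 2 + s * j)) /
        (1 - exp (2 * Real.pi * I * z₁) * exp (2 * Real.pi * I * τ * j))

/-- `Φ₂^{[m,s]}(τ, z₁, z₂, t)`. -/
def Phi2 (m s : ℝ) (τ z₁ z₂ t : ℂ) : ℂ :=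
  exp (-(2 * Real.pi * I * m * t)) *
    ∑' j : ℤ,
      exp (-(2 * Real.pi * I * m * j * (z₁ + z₂)) - 2 * Real.pi * I * s * z₂) *
          exp (2 * Real.pi * I * τ * (m * (j : ℂ) ^ 2 + s * j)) /
        (1 - exp (-(2 * Real.pi * I * z₂)) * exp (2 * Real.pi * I * τ * j))

/-- `Φ^{[m,s]} = Φ₁^{[m,s]} - Φ₂^{[m,s]}`. -/
def Phi (m s : ℝ) (τ z₁ z₂ t : ℂ) : ℂ :=
  Phi1 m s τ z₁ z₂ t - Phi2 m s τ z₁ z₂ t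

/-- The function `R_{j;m}(τ, w)`, a sum over all `n ≡ j mod 2m`; these are written
`n = j + 2ml` with `l ∈ ℤ`. -/
def zwegersR (j m : ℝ) (τ w : ℂ) : ℂ :=
  ∑' l : ℤ,
    let n : ℝ := j + 2 * m * l
    ((Real.sign (n - 1 / 2 - j + 2 * m) -
          errE ((n - 2 * m * (w.im / τ.im)) * Real.sqrt (τ.im / m)) : ℝ) : ℂ) *
      exp (-(Real.pi * I * (n : ℂ) ^ 2 * τ / (2 * m)) + 2 * Real.pi * I * n * w)

/-- The correction term `Φ_add^{[m;s]}`. The sum over `k ∈ s + ℤ` with `s ≤ k < s + 2m` is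
written with `k = s + i`, where `i` is a natural number less than `2m`. -/
def PhiAdd (m s : ℝ) (τ z₁ z₂ t : ℂ) : ℂ :=
  -(1 / 2) * exp (-(2 * Real.pi * I * m * t)) *
    ∑ i ∈ Finset.range ⌈2 * m⌉₊,
      zwegersR (s + i) m τ ((z₁ - z₂) / 2) *
        (jacobiTheta (s + i) m τ (z₁ + z₂) - jacobiTheta (-(s + i)) m τ (z₁ + z₂))

/-- Zwegers' modification of `Φ^{[m,s]}`. -/
def PhiTilde (m s : ℝ) (τ z₁ z₂ t : ℂ) : ℂ :=
  Phi m s τ z₁ z₂ t + PhiAdd m s τ z₁ z₂ t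

/-- The shift `c_j(τ)`, `1 ≤ j ≤ 6`, for which
`Ã_j^{[m]}(τ, z) = Φ̃^{[m,0]}(τ, z/2 + c_j(τ), z/2 - c_j(τ), 0)`.
Only the indices `1, …, 6` are used. -/
def shift : ℕ → ℂ → ℂ
  | 1, τ => τ / 4 + 1 / 4
  | 2, τ => τ / 4 - 1 / 4
  | 3, τ => τ / 4 + 1 / 2
  | 4, τ => τ / 4
  | 5, _ => 1 / 4
  | 6, τ => τ / 2 - 1 / 4
  | _, _ => 0

/-- `Ã_j^{[m]}(τ, z)`. -/
def ATilde (m j : ℕ) (τ z : ℂ) : ℂ :=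
  PhiTilde m 0 τ (z / 2 + shift j τ) (z / 2 - shift j τ) 0

/-- `Å_j^{[m]}(τ, z)`: the function `Ã_j^{[m]}` multiplied by `e^{-πimτ/8}` for `1 ≤ j ≤ 4`,
by `1` for `j = 5` and by `e^{-πimτ/2}` for `j = 6`. -/
def ARing (m : ℕ) : ℕ → ℂ → ℂ → ℂ
  | 5, τ, z => ATilde m 5 τ z
  | 6, τ, z => exp (-(Real.pi * I * m * τ / 2)) * ATilde m 6 τ z
  | j, τ, z => exp (-(Real.pi * I * m * τ / 8)) * ATilde m j τ z

/-- `(τ, z)` is not a pole of `Å_j^{[m]}`: neither of the two arguments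
`z₁ = z/2 + c_j(τ)`, `z₂ = z/2 - c_j(τ)` lies in `ℤ + ℤτ`, so that no denominator in the series
for `Φ₁` and `Φ₂` vanishes. This condition does not depend on `m`. -/
def IsRegular (j : ℕ) (τ z : ℂ) : Prop :=
  ∀ a b : ℤ, z / 2 + shift j τ ≠ a + b * τ ∧ z / 2 - shift j τ ≠ a + b * τ

end MockTheta

end

section

open Complex MockTheta

/-! The completed function is a Gaussian-weighted sum over a lattice, and each identity expresses
that one lattice is a union of two translates of an index two sublattice. For `z₁ = w + c`, `z₂ = w
- c`, `s = 0`, `PhiTilde` is, up to the factor `-1/(2πi)`, the antisymmetrisation in `w` of `∑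
exp(-(πm/Im τ) Q(l)) / (w + c + l)` over `l ∈ ℤτ + ℤ`, where `Q` is `latticeForm w c`
(`PhiTilde_eq_tsum_latticeTerm`).

The analytic core is `inv_one_sub_exp_sub_tsum_sgnZ`: `1/(1 - e^{2πiu})`, minus half its
error-function regularisation, is a Gaussian sum of `1/(u + b)` over `b ∈ ℤ`. By Poisson summation
the difference `D(ν)` of the two sides has derivative zero. It also satisfies `D(ν + 1) = e^{2πiu}
D(ν)` with `e^{2πiu} ≠ 1`, so it vanishes. Applying this with `u = w + c + jτ` for each `j` turns
`Phi1` minus its half of the correction term into the lattice sum; `sum_zwegersR_mul_jacobiTheta`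
shows that the products `R · θ` supply exactly the regularising series.

If multiplication by `μ` carries two translates of `ℤτ + ℤ`, up to sign, onto the two halves of `c'
+ ℤτ' + ℤ`, then `m/Im τ'` times `|μ|²` equals `2m/Im τ`. This is why the index doubles from `m` to
`2m`. The constants in the identities are the factors `e^k` by which the exponentials differ on each
half. -/

/-! ### The error function and its Gaussian tail -/

theorem hasDerivAt_errE (x : ℝ) : HasDerivAt errE (2 * Real.exp (-Real.pi * x ^ 2)) x := by
  unfold errE
  have hc : Continuous fun t : ℝ => Real.exp (-Real.pi * t ^ 2) := by fun_prop
  exact (intervalIntegral.integral_hasDerivAt_right (hc.intervalIntegrable _ _)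
    (hc.stronglyMeasurableAtFilter _ _) hc.continuousAt).const_mul 2

theorem errE_neg (x : ℝ) : errE (-x) = -errE x := by
  unfold errE
  have := intervalIntegral.integral_comp_neg (a := 0) (b := x)
    (fun t : ℝ => Real.exp (-Real.pi * t ^ 2))
  simp only [neg_zero, neg_sq] at this
  rw [this, intervalIntegral.integral_symm]
  ring

theorem one_sub_errE {x : ℝ} :
    1 - errE x = 2 * ∫ t in Set.Ioi (0 : ℝ), Real.exp (-Real.pi * (t + x) ^ 2) := by
  have hi : MeasureTheory.Integrable fun t : ℝ => Real.exp (-Real.pi * t ^ 2) :=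
    integrable_exp_neg_mul_sq Real.pi_pos
  have h1 := integral_gaussian_Ioi Real.pi
  rw [div_self Real.pi_ne_zero, Real.sqrt_one] at h1
  have h2 := (MeasureTheory.measurePreserving_add_right MeasureTheory.volume
    x).setIntegral_preimage_emb (measurableEmbedding_addRight x)
    (fun t : ℝ => Real.exp (-Real.pi * t ^ 2)) (Set.Ioi x)
  have h3 := intervalIntegral.integral_interval_add_Ioi (a := 0) (b := x)
    (hi.integrableOn (s := Set.Ioi 0)) (hi.integrableOn (s := Set.Ioi x))
  rw [Set.preimage_add_const_Ioi, sub_self] at h2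
  rw [h2, errE]
  linarith

theorem one_sub_errE_nonneg (x : ℝ) : 0 ≤ 1 - errE x := by
  rw [one_sub_errE]
  exact mul_nonneg two_pos.le (MeasureTheory.integral_nonneg fun _ => (Real.exp_pos _).le)

theorem one_sub_errE_le {x : ℝ} (hx : 0 ≤ x) : 1 - errE x ≤ Real.exp (-Real.pi * x ^ 2) := by
  have hi : MeasureTheory.Integrable fun t : ℝ => Real.exp (-Real.pi * t ^ 2) :=
    integrable_exp_neg_mul_sq Real.pi_pos
  have h1 := integral_gaussian_Ioi Real.pi
  rw [div_self Real.pi_ne_zero, Real.sqrt_one] at h1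
  have h : ∫ t in Set.Ioi (0 : ℝ), Real.exp (-Real.pi * (t + x) ^ 2) ≤
      ∫ t in Set.Ioi (0 : ℝ), Real.exp (-Real.pi * x ^ 2) * Real.exp (-Real.pi * t ^ 2) := by
    refine MeasureTheory.setIntegral_mono_on (hi.comp_add_right x).integrableOn
      (hi.const_mul _).integrableOn measurableSet_Ioi fun t ht => ?_
    rw [← Real.exp_add, Real.exp_le_exp]
    have : 0 ≤ Real.pi * (t * x) := mul_nonneg Real.pi_pos.le (mul_nonneg (le_of_lt ht) hx)
    nlinarith
  rw [MeasureTheory.integral_const_mul, h1] at h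
  rw [one_sub_errE]
  linarith

theorem abs_errE_le_one (x : ℝ) : |errE x| ≤ 1 := by
  have h1 := one_sub_errE_nonneg x
  have h2 := one_sub_errE_nonneg (-x)
  rw [errE_neg] at h2
  exact abs_le.2 ⟨by linarith, by linarith⟩

/-- The sign of an integer, with the sign of `0` being `1`. -/
def sgnZ (n : ℤ) : ℝ := if 0 ≤ n then 1 else -1

/-- If `n` and `n - ν` have the same sign, the Gaussian tail bound applies. Otherwise `n` lies
between `0` and `ν`, so `|n - ν| ≤ |ν|`; there the trivial bound `2` suffices, and the factor
`exp(πs²ν²)` absorbs it. -/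
theorem abs_sgnZ_sub_errE_le {s : ℝ} (hs : 0 < s) (ν : ℝ) (n : ℤ) :
    |sgnZ n - errE ((n - ν) * s)| ≤
      2 * Real.exp (Real.pi * s ^ 2 * ν ^ 2) * Real.exp (-Real.pi * ((n - ν) * s) ^ 2) := by
  have hA : 1 ≤ Real.exp (Real.pi * s ^ 2 * ν ^ 2) := Real.one_le_exp (by positivity)
  have hB := Real.exp_pos (-Real.pi * ((n - ν) * s) ^ 2)
  have key : Real.exp (-Real.pi * ((n - ν) * s) ^ 2) ≤
      2 * Real.exp (Real.pi * s ^ 2 * ν ^ 2) * Real.exp (-Real.pi * ((n - ν) * s) ^ 2) := by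
    nlinarith [mul_le_mul_of_nonneg_right hA hB.le]
  have triv : ((n : ℝ) - ν) ^ 2 ≤ ν ^ 2 → |sgnZ n - errE ((n - ν) * s)| ≤
      2 * Real.exp (Real.pi * s ^ 2 * ν ^ 2) * Real.exp (-Real.pi * ((n - ν) * s) ^ 2) := by
    intro h
    have h1 : |sgnZ n| = 1 := by unfold sgnZ; split_ifs <;> simp
    have h2 := abs_errE_le_one ((n - ν) * s)
    rw [mul_assoc, ← Real.exp_add]
    have h3 : 1 ≤ Real.exp (Real.pi * s ^ 2 * ν ^ 2 + -Real.pi * ((n - ν) * s) ^ 2) := by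
      refine Real.one_le_exp ?_
      have : 0 ≤ Real.pi * s ^ 2 * (ν ^ 2 - (n - ν) ^ 2) :=
        mul_nonneg (by positivity) (by linarith)
      nlinarith
    have := abs_sub (sgnZ n) (errE ((n - ν) * s))
    linarith
  rcases le_or_gt 0 n with hn | hn <;> rcases le_or_gt ν n with hν | hν
  · have hx : 0 ≤ (n - ν) * s := mul_nonneg (by linarith) hs.le
    rw [sgnZ, if_pos hn, abs_of_nonneg (one_sub_errE_nonneg _)]
    exact (one_sub_errE_le hx).trans key
  · have hn' : (0 : ℝ) ≤ n := by exact_mod_cast hn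
    exact triv (by nlinarith)
  · have hn' : (n : ℝ) < 0 := by exact_mod_cast hn
    exact triv (by nlinarith)
  · have hx : 0 ≤ -((n - ν) * s) := by nlinarith
    have h1 := one_sub_errE_le hx
    have h2 := one_sub_errE_nonneg (-((n - ν) * s))
    rw [errE_neg] at h1 h2
    rw [sgnZ, if_neg (not_le.2 hn), abs_sub_comm, abs_of_nonneg (by linarith)]
    refine le_trans ?_ key
    rw [neg_sq] at h1
    linarith

/-! ### Convergence of theta-like series -/

theorem summable_jacobiTheta₂_term {z τ : ℂ} (hτ : 0 < τ.im) :
    Summable fun n : ℤ => jacobiTheta₂_term n z τ :=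
  (summable_jacobiTheta₂_term_iff z τ).2 hτ

/-- The Gaussian decay of `sgnZ n - errE` adds `s²` to `Im σ`, so even a growing quadratic
exponential is allowed. Needed for `σ = 0` and for `σ = -τ/(2m)` with `s² = Im τ/m`. -/
theorem summable_sgnZ_sub_errE_mul_exp {s : ℝ} (hs : 0 < s) (ν : ℝ) (z σ : ℂ)
    (h : 0 < σ.im + s ^ 2) :
    Summable fun n : ℤ => ((sgnZ n - errE ((n - ν) * s) : ℝ) : ℂ) *
      exp (2 * Real.pi * I * n * z + Real.pi * I * n ^ 2 * σ) := by
  have him : 0 < (σ + I * (s : ℂ) ^ 2).im := by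
    have : (I * (s : ℂ) ^ 2).im = s ^ 2 := by rw [← ofReal_pow, I_mul_im, ofReal_re]
    rw [add_im, this]; exact h
  refine Summable.of_norm_bounded
    (((summable_jacobiTheta₂_term (z := z - I * s ^ 2 * ν) him).norm).mul_left 2) fun n => ?_
  rw [norm_mul, norm_real, Real.norm_eq_abs]
  refine (mul_le_mul_of_nonneg_right (abs_sgnZ_sub_errE_le hs ν n) (norm_nonneg _)).trans ?_
  rw [jacobiTheta₂_term, norm_exp, norm_exp, mul_assoc, mul_assoc, ← Real.exp_add, ← Real.exp_add]
  refine le_of_eq ?_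
  congr 2
  simp only [add_re, mul_re, sub_re, I_re, I_im, ofReal_re, ofReal_im, re_ofNat, im_ofNat,
    intCast_re, intCast_im, mul_im, sub_im, add_im, pow_two]
  ring

theorem summable_div_of_summable_norm_cofinite {ι : Type*} {f x : ι → ℂ}
    (hf : Summable f) (hx : ∀ᶠ i in Filter.cofinite, 1 ≤ ‖x i‖) :
    Summable fun i => f i / x i := by
  refine Summable.of_norm_bounded_eventually hf.norm (hx.mono fun i hi => ?_)
  rw [norm_div]
  exact div_le_self (norm_nonneg _) hi

theorem eventually_one_le_norm_add_intCast (u : ℂ) :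
    ∀ᶠ b : ℤ in Filter.cofinite, 1 ≤ ‖u + b‖ := by
  have h : Filter.Tendsto (fun b : ℤ => ‖((b : ℝ) : ℝ)‖) Filter.cofinite Filter.atTop :=
    tendsto_norm_cocompact_atTop.comp Int.tendsto_coe_cofinite
  filter_upwards [h.eventually_ge_atTop (1 + ‖u‖)] with b hb
  have h1 : ‖(b : ℂ)‖ = ‖(b : ℝ)‖ := by rw [← ofReal_intCast, norm_real]
  have h2 := norm_sub_le (u + b) u
  rw [add_sub_cancel_left, h1] at h2
  linarith

/-! ### The regularised geometric series -/

/-- Poisson summation, in the form of the functional equation of `jacobiTheta₂` at `τ = i s²`; the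
centre `ν` is moved into the elliptic variable by completing the square. -/
theorem tsum_gaussian_eq {s : ℝ} (hs : 0 < s) (ν : ℝ) (u : ℂ) :
    ∑' n : ℤ, (s * Real.exp (-Real.pi * ((n - ν) * s) ^ 2) : ℝ) * exp (2 * Real.pi * I * n * u) =
      ∑' b : ℤ, exp (2 * Real.pi * I * ν * (u + b) - Real.pi * (u + b) ^ 2 / s ^ 2) := by
  have hs' : (s : ℂ) ≠ 0 := ofReal_ne_zero.2 hs.ne'
  have h := jacobiTheta₂_functional_equation (u - I * s ^ 2 * ν) (I * s ^ 2)
  have h1 : (-I * (I * (s : ℂ) ^ 2)) ^ (1 / 2 : ℂ) = s := by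
    rw [← mul_assoc, neg_mul, I_mul_I, neg_neg, one_mul, ← ofReal_pow]
    rw [show (1 / 2 : ℂ) = ((1 / 2 : ℝ) : ℂ) by push_cast; rfl, ← ofReal_cpow (by positivity),
      ← Real.sqrt_eq_rpow, Real.sqrt_sq hs.le]
  have h2 : (u - I * s ^ 2 * ν) / (I * s ^ 2) = -(ν + I * u / s ^ 2) := by
    field_simp
    ring_nf
    simp only [I_sq]
    ring
  have h3 : -1 / (I * (s : ℂ) ^ 2) = I / s ^ 2 := by
    field_simp
    rw [I_sq]
  rw [h1, h2, h3, jacobiTheta₂_neg_left] at h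
  have hL : ∀ n : ℤ, ((s * Real.exp (-Real.pi * ((n - ν) * s) ^ 2) : ℝ) : ℂ) *
      exp (2 * Real.pi * I * n * u) = s * exp (-Real.pi * s ^ 2 * ν ^ 2) *
        jacobiTheta₂_term n (u - I * s ^ 2 * ν) (I * s ^ 2) := by
    intro n
    rw [jacobiTheta₂_term, ofReal_mul, ofReal_exp, mul_assoc (s : ℂ), mul_assoc (s : ℂ), ← exp_add,
      ← exp_add]
    congr 2
    push_cast
    ring_nf
    simp only [I_sq]
    ring
  have hR : ∀ b : ℤ, exp (2 * Real.pi * I * ν * (u + b) - Real.pi * (u + b) ^ 2 / s ^ 2) =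
      exp (2 * Real.pi * I * ν * u - Real.pi * u ^ 2 / s ^ 2) *
        jacobiTheta₂_term b (ν + I * u / s ^ 2) (I / s ^ 2) := by
    intro n
    rw [jacobiTheta₂_term, ← exp_add]
    congr 1
    field_simp
    ring_nf
    simp only [I_sq]
    ring
  simp_rw [hL, hR]
  rw [tsum_mul_left, tsum_mul_left, ← jacobiTheta₂, ← jacobiTheta₂, h, ← mul_assoc]
  congr 1
  field_simp
  rw [← exp_add]
  congr 1
  field_simp
  ring_nf
  simp only [I_sq]
  ring

/-- The derivative in `ν` of the series defining the regularised geometric series. -/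
theorem hasDerivAt_tsum_sgnZ {s : ℝ} (hs : 0 < s) (u : ℂ) (ν : ℝ) :
    HasDerivAt (fun ν : ℝ => ∑' n : ℤ, ((sgnZ n - errE ((n - ν) * s) : ℝ) : ℂ) *
        exp (2 * Real.pi * I * n * u))
      (∑' n : ℤ, ((2 * (s * Real.exp (-Real.pi * ((n - ν) * s) ^ 2)) : ℝ) : ℂ) *
        exp (2 * Real.pi * I * n * u)) ν := by
  set S : ℝ := |u.im| + s ^ 2 * (|ν| + 1)
  have hT : 0 < s ^ 2 := by positivity
  have hsum := (summable_pow_mul_jacobiTheta₂_term_bound S hT 0).mul_left (2 * s)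
  have hν : ν ∈ Set.Ioo (ν - 1) (ν + 1) := ⟨by linarith, by linarith⟩
  refine hasDerivAt_tsum_of_isPreconnected
    (t := Set.Ioo (ν - 1) (ν + 1)) (y₀ := ν) (y := ν)
    (g := fun (n : ℤ) (ν : ℝ) => ((sgnZ n - errE ((n - ν) * s) : ℝ) : ℂ) *
      exp (2 * Real.pi * I * n * u))
    (g' := fun (n : ℤ) (ν : ℝ) =>
      ((2 * (s * Real.exp (-Real.pi * ((n - ν) * s) ^ 2)) : ℝ) : ℂ) *
        exp (2 * Real.pi * I * n * u))
    hsum isOpen_Ioo isPreconnected_Ioo ?_ ?_ hν ?_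
    hν
  · intro n y _
    have h1 : HasDerivAt (fun y : ℝ => ((n : ℝ) - y) * s) (-s) y := by
      simpa using ((hasDerivAt_id y).const_sub (n : ℝ)).mul_const s
    have h2 := ((hasDerivAt_errE _).comp y h1).const_sub (sgnZ n)
    refine (h2.ofReal_comp.mul_const _).congr_deriv ?_
    push_cast
    ring
  · intro n y hy
    have hy' : |y| ≤ |ν| + 1 := by
      have := abs_sub_abs_le_abs_sub y ν
      have h2 : |y - ν| ≤ 1 := abs_le.2 ⟨by linarith [hy.1], by linarith [hy.2]⟩
      linarith
    have hb := norm_jacobiTheta₂_term_le (S := S) (z := u - I * s ^ 2 * y) (τ := I * s ^ 2) hT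
      (by
        have : (u - I * s ^ 2 * y).im = u.im - s ^ 2 * y := by
          simp [pow_two]
        rw [this]
        refine (abs_sub _ _).trans ?_
        rw [abs_mul, abs_of_pos hT]
        exact add_le_add_right (mul_le_mul_of_nonneg_left hy' hT.le) _)
      (by simp [pow_two]) n
    have hL : ‖((2 * (s * Real.exp (-Real.pi * ((n - y) * s) ^ 2)) : ℝ) : ℂ) *
        exp (2 * Real.pi * I * n * u)‖ = 2 * s * (Real.exp (-Real.pi * s ^ 2 * y ^ 2) *
          ‖jacobiTheta₂_term n (u - I * s ^ 2 * y) (I * s ^ 2)‖) := by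
      rw [jacobiTheta₂_term, norm_mul, norm_real, Real.norm_eq_abs, norm_exp, norm_exp,
        abs_of_nonneg (by positivity), mul_assoc, mul_assoc, mul_assoc, ← Real.exp_add,
        ← Real.exp_add]
      rw [← mul_assoc]
      congr 2
      simp only [add_re, mul_re, sub_re, I_re, I_im, ofReal_re, ofReal_im, re_ofNat, im_ofNat,
        intCast_re, intCast_im, mul_im, sub_im, pow_two]
      ring
    rw [hL, pow_zero, one_mul]
    gcongr
    refine (mul_le_of_le_one_left (norm_nonneg _) ?_).trans hb
    rw [Real.exp_le_one_iff]
    have : 0 ≤ Real.pi * s ^ 2 * y ^ 2 := by positivity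
    linarith
  · simpa using summable_sgnZ_sub_errE_mul_exp hs ν u 0 (by simpa using hT)

theorem summable_gaussian_div {s : ℝ} (hs : 0 < s) (u : ℂ) (ν : ℝ) :
    Summable fun b : ℤ =>
      exp (2 * Real.pi * I * ν * (u + b) - Real.pi * (u + b) ^ 2 / s ^ 2) / (u + b) := by
  refine summable_div_of_summable_norm_cofinite ?_ (eventually_one_le_norm_add_intCast u)
  have him : 0 < (I / (s : ℂ) ^ 2).im := by
    rw [← ofReal_pow, div_ofReal_im, I_im]; positivity
  refine ((summable_jacobiTheta₂_term (z := ν + I * u / s ^ 2) him).mul_left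
    (exp (2 * Real.pi * I * ν * u - Real.pi * u ^ 2 / s ^ 2))).congr fun b => ?_
  have hs' : (s : ℂ) ≠ 0 := ofReal_ne_zero.2 hs.ne'
  rw [jacobiTheta₂_term, ← exp_add]
  congr 1
  field_simp
  ring_nf
  simp only [I_sq]
  ring

/-- Differentiating in `ν` brings down `2πi(u + b)`, which cancels the denominator and leaves a pure
theta series. -/
theorem hasDerivAt_tsum_gaussian_div {s : ℝ} (hs : 0 < s) {u : ℂ} (hu : ∀ b : ℤ, u + b ≠ 0) (ν : ℝ) :
    HasDerivAt (fun ν : ℝ => ∑' b : ℤ,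
        exp (2 * Real.pi * I * ν * (u + b) - Real.pi * (u + b) ^ 2 / s ^ 2) / (u + b))
      (∑' b : ℤ, 2 * Real.pi * I *
        exp (2 * Real.pi * I * ν * (u + b) - Real.pi * (u + b) ^ 2 / s ^ 2)) ν := by
  have hs' : (s : ℂ) ≠ 0 := ofReal_ne_zero.2 hs.ne'
  have hT : 0 < (s ^ 2)⁻¹ := by positivity
  set S : ℝ := |u.re| * (s ^ 2)⁻¹
  set A : ℝ := 2 * Real.pi * Real.exp (2 * Real.pi * (|ν| + 1) * |u.im| +
    Real.pi * |(u ^ 2).re| * (s ^ 2)⁻¹)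
  have hsum := (summable_pow_mul_jacobiTheta₂_term_bound S hT 0).mul_left A
  have hν : ν ∈ Set.Ioo (ν - 1) (ν + 1) := ⟨by linarith, by linarith⟩
  refine hasDerivAt_tsum_of_isPreconnected
    (t := Set.Ioo (ν - 1) (ν + 1)) (y₀ := ν) (y := ν)
    (g := fun (b : ℤ) (ν : ℝ) =>
      exp (2 * Real.pi * I * ν * (u + b) - Real.pi * (u + b) ^ 2 / s ^ 2) / (u + b))
    (g' := fun (b : ℤ) (ν : ℝ) => 2 * Real.pi * I *
      exp (2 * Real.pi * I * ν * (u + b) - Real.pi * (u + b) ^ 2 / s ^ 2))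
    hsum isOpen_Ioo isPreconnected_Ioo ?_ ?_ hν
    (summable_gaussian_div hs u ν) hν
  · intro n y _
    have h1 : HasDerivAt (fun y : ℝ => 2 * Real.pi * I * y * (u + n) -
        Real.pi * (u + n) ^ 2 / s ^ 2) (2 * Real.pi * I * (u + n)) y := by
      simpa using (((hasDerivAt_id y).ofReal_comp.const_mul (2 * Real.pi * I)).mul_const
        (u + n)).sub_const (Real.pi * (u + n) ^ 2 / s ^ 2 : ℂ)
    refine (h1.cexp.div_const _).congr_deriv ?_
    field_simp [hu n]
  · intro n y hy
    have hy' : |y| ≤ |ν| + 1 := by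
      have := abs_sub_abs_le_abs_sub y ν
      have h2 : |y - ν| ≤ 1 := abs_le.2 ⟨by linarith [hy.1], by linarith [hy.2]⟩
      linarith
    have e1 : (y + I * u / s ^ 2).im = u.re * (s ^ 2)⁻¹ := by
      rw [← ofReal_pow, add_im, div_ofReal_im]; simp [div_eq_mul_inv]
    have e2 : (I / (s : ℂ) ^ 2).im = (s ^ 2)⁻¹ := by
      rw [← ofReal_pow, div_ofReal_im]; simp
    have hb := norm_jacobiTheta₂_term_le (S := S) (z := y + I * u / s ^ 2) (τ := I / s ^ 2) hT
      (by rw [e1, abs_mul, abs_of_pos hT]) e2.ge n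
    have e3 : 2 * Real.pi * I *
        exp (2 * Real.pi * I * y * (u + n) - Real.pi * (u + n) ^ 2 / s ^ 2) =
        2 * Real.pi * I * (exp (2 * Real.pi * I * y * u - Real.pi * u ^ 2 / s ^ 2) *
          jacobiTheta₂_term n (y + I * u / s ^ 2) (I / s ^ 2)) := by
      rw [jacobiTheta₂_term, ← exp_add]
      congr 2
      field_simp
      ring_nf
      simp only [I_sq]
      ring
    have e4 : (2 * Real.pi * I * y * u - Real.pi * u ^ 2 / s ^ 2 : ℂ).re =
        -(2 * Real.pi * y * u.im) - Real.pi * (u ^ 2).re * (s ^ 2)⁻¹ := by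
      rw [← ofReal_pow, sub_re, div_ofReal_re, re_ofReal_mul, div_eq_mul_inv]
      simp
    have e5 : ‖2 * (Real.pi : ℂ) * I‖ = 2 * Real.pi := by
      simp [abs_of_pos Real.pi_pos]
    rw [e3, pow_zero, one_mul, norm_mul (2 * Real.pi * I : ℂ), e5, norm_mul, ← mul_assoc,
      norm_exp, e4]
    have e6 : -(2 * Real.pi * y * u.im) ≤ 2 * Real.pi * (|ν| + 1) * |u.im| := by
      have : -(y * u.im) ≤ (|ν| + 1) * |u.im| :=
        (neg_le_abs _).trans (by rw [abs_mul]; gcongr)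
      nlinarith [Real.pi_pos]
    have e7 : -(Real.pi * (u ^ 2).re * (s ^ 2)⁻¹) ≤ Real.pi * |(u ^ 2).re| * (s ^ 2)⁻¹ := by
      have : -(u ^ 2).re ≤ |(u ^ 2).re| := neg_le_abs _
      have h8 : 0 ≤ Real.pi * (s ^ 2)⁻¹ := by positivity
      nlinarith [mul_le_mul_of_nonneg_left this h8]
    exact mul_le_mul (mul_le_mul_of_nonneg_left (Real.exp_le_exp.2 (by linarith)) (by positivity))
      hb (norm_nonneg _) (by positivity)

theorem exp_two_pi_I_mul_ne_one {u : ℂ} (hu : ∀ b : ℤ, u + b ≠ 0) : exp (2 * Real.pi * I * u) ≠ 1 := by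
  intro h
  obtain ⟨n, hn⟩ := exp_eq_one_iff.1 h
  apply hu (-n)
  have : (2 * Real.pi * I : ℂ) ≠ 0 := two_pi_I_ne_zero
  have h2 : (2 * Real.pi * I : ℂ) * (u + (-n : ℤ)) = 0 := by
    push_cast
    linear_combination hn
  exact (mul_eq_zero.1 h2).resolve_left this

theorem sgnZ_add_one (n : ℤ) : sgnZ (n + 1) = sgnZ n + if n = -1 then 2 else 0 := by
  unfold sgnZ
  rcases lt_trichotomy n (-1) with h | h | h
  · rw [if_neg (by omega), if_neg (by omega), if_neg (by omega), add_zero]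
  · rw [if_pos (by omega), if_neg (by omega), if_pos h]
    norm_num
  · rw [if_pos (by omega), if_pos (by omega), if_neg (by omega), add_zero]

/-- Reindexing by `n ↦ n + 1` preserves the error function argument; only the sign jumps, once, from
`n = -1` to `0`, which produces the summand `2`. -/
theorem tsum_sgnZ_shift {s : ℝ} (hs : 0 < s) (u : ℂ) (ν : ℝ) :
    ∑' n : ℤ, ((sgnZ n - errE ((n - (ν + 1 : ℝ)) * s) : ℝ) : ℂ) * exp (2 * Real.pi * I * n * u) =
      2 + exp (2 * Real.pi * I * u) * ∑' n : ℤ, ((sgnZ n - errE ((n - ν) * s) : ℝ) : ℂ) *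
        exp (2 * Real.pi * I * n * u) := by
  have hsum : Summable fun n : ℤ => ((sgnZ n - errE ((n - ν) * s) : ℝ) : ℂ) *
      exp (2 * Real.pi * I * n * u) := by
    simpa using summable_sgnZ_sub_errE_mul_exp hs ν u 0 (by simp; positivity)
  have key := (hasSum_ite_eq (-1 : ℤ) (2 : ℂ)).add
    (hsum.hasSum.mul_left (exp (2 * Real.pi * I * u)))
  rw [← key.tsum_eq, ← (Equiv.addRight (1 : ℤ)).tsum_eq]
  refine tsum_congr fun n => ?_
  have e1 : ((((Equiv.addRight (1 : ℤ)) n : ℤ) : ℝ) - (ν + 1)) = n - ν := by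
    simp
  have e2 : exp (2 * Real.pi * I * ((Equiv.addRight (1 : ℤ)) n : ℤ) * u) =
      exp (2 * Real.pi * I * u) * exp (2 * Real.pi * I * n * u) := by
    rw [← exp_add]
    congr 1
    simp
    ring
  rw [e1, e2]
  have e3 : sgnZ ((Equiv.addRight (1 : ℤ)) n) = sgnZ n + if n = -1 then 2 else 0 := by
    exact sgnZ_add_one n
  rw [e3]
  split_ifs with h
  · have : exp (2 * Real.pi * I * u) * exp (2 * Real.pi * I * n * u) = 1 := by
      rw [← exp_add, h]
      simp
    push_cast
    linear_combination 2 * this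
  · push_cast
    ring

theorem tsum_gaussian_div_shift (s : ℝ) (u : ℂ) (ν : ℝ) :
    ∑' b : ℤ, exp (2 * Real.pi * I * (ν + 1 : ℝ) * (u + b) - Real.pi * (u + b) ^ 2 / s ^ 2) /
        (u + b) =
      exp (2 * Real.pi * I * u) * ∑' b : ℤ,
        exp (2 * Real.pi * I * ν * (u + b) - Real.pi * (u + b) ^ 2 / s ^ 2) / (u + b) := by
  rw [← tsum_mul_left]
  refine tsum_congr fun b => ?_
  rw [← mul_div_assoc, ← exp_add]
  congr 1
  rw [exp_eq_exp_iff_exists_int]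
  exact ⟨b, by push_cast; ring⟩

/-- The regularised geometric series as a sum over the lattice `ℤ`. -/
theorem inv_one_sub_exp_sub_tsum_sgnZ {s : ℝ} (hs : 0 < s) {u : ℂ} (hu : ∀ b : ℤ, u + b ≠ 0) (ν : ℝ) :
    1 / (1 - exp (2 * Real.pi * I * u)) -
        1 / 2 * ∑' n : ℤ, ((sgnZ n - errE ((n - ν) * s) : ℝ) : ℂ) *
          exp (2 * Real.pi * I * n * u) =
      -1 / (2 * Real.pi * I) * ∑' b : ℤ,
        exp (2 * Real.pi * I * ν * (u + b) - Real.pi * (u + b) ^ 2 / s ^ 2) / (u + b) := by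
  set D : ℝ → ℂ := fun ν => 1 / (1 - exp (2 * Real.pi * I * u)) -
        1 / 2 * ∑' n : ℤ, ((sgnZ n - errE ((n - ν) * s) : ℝ) : ℂ) *
          exp (2 * Real.pi * I * n * u) - -1 / (2 * Real.pi * I) * ∑' b : ℤ,
        exp (2 * Real.pi * I * ν * (u + b) - Real.pi * (u + b) ^ 2 / s ^ 2) / (u + b) with hD
  have hne : 1 - exp (2 * Real.pi * I * u) ≠ 0 :=
    sub_ne_zero.2 (exp_two_pi_I_mul_ne_one hu).symm
  have h2 : (2 * Real.pi * I : ℂ) ≠ 0 := two_pi_I_ne_zero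
  have hder : ∀ x, HasDerivAt D 0 x := by
    intro x
    refine ((((hasDerivAt_tsum_sgnZ hs u x).const_mul (1 / 2 : ℂ)).const_sub _).sub
      ((hasDerivAt_tsum_gaussian_div hs hu x).const_mul (-1 / (2 * Real.pi * I)))).congr_deriv ?_
    have e : ∑' n : ℤ, ((2 * (s * Real.exp (-Real.pi * ((n - x) * s) ^ 2)) : ℝ) : ℂ) *
        exp (2 * Real.pi * I * n * u) = 2 * ∑' b : ℤ,
        exp (2 * Real.pi * I * x * (u + b) - Real.pi * (u + b) ^ 2 / s ^ 2) := by
      rw [← tsum_gaussian_eq hs, ← tsum_mul_left]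
      refine tsum_congr fun n => ?_
      push_cast
      ring
    rw [e, tsum_mul_left]
    field_simp
    ring
  -- Constancy and quasi-periodicity with multiplier different from `1` together force `D = 0`.
  have hconst : D (ν + 1) = D ν := is_const_of_deriv_eq_zero
    (fun x => (hder x).differentiableAt) (fun x => (hder x).deriv) _ _
  have hshift : D (ν + 1) = exp (2 * Real.pi * I * u) * D ν := by
    simp only [hD]
    rw [tsum_sgnZ_shift hs, tsum_gaussian_div_shift]
    generalize (∑' n : ℤ, ((sgnZ n - errE ((n - ν) * s) : ℝ) : ℂ) *
          exp (2 * Real.pi * I * n * u)) = A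
    generalize (∑' b : ℤ, exp (2 * Real.pi * I * ν * (u + b) - Real.pi * (u + b) ^ 2 / s ^ 2) /
      (u + b)) = B
    field_simp
    ring
  have : (1 - exp (2 * Real.pi * I * u)) * D ν = 0 := by
    linear_combination hshift - hconst
  exact sub_eq_zero.1 ((mul_eq_zero.1 this).resolve_left hne)

/-! ### Convergence of the lattice sum -/

/-- The exponent of the summands of the lattice sum. -/
noncomputable def latticeForm (w c l : ℂ) : ℂ :=
  l * (starRingEnd ℂ) l + 2 * (starRingEnd ℂ) l * w + 2 * (starRingEnd ℂ) c * l +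
    2 * (starRingEnd ℂ) c * w + w ^ 2 - c ^ 2 + 2 * c * (starRingEnd ℂ) c

/-- The point of the lattice `ℤ τ + ℤ` with given coordinates. -/
noncomputable def latticePt (τ : ℂ) (p : ℤ × ℤ) : ℂ := p.1 * τ + p.2

/-- The summand of the lattice sum. -/
noncomputable def latticeTerm (m : ℕ) (τ w c : ℂ) (p : ℤ × ℤ) : ℂ :=
  exp (-(Real.pi * m / τ.im) * latticeForm w c (latticePt τ p)) / (w + c + latticePt τ p)

theorem norm_latticePt_sq (τ : ℂ) (p : ℤ × ℤ) :
    ‖latticePt τ p‖ ^ 2 = (p.1 * τ.re + p.2) ^ 2 + (p.1 * τ.im) ^ 2 := by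
  rw [← normSq_eq_norm_sq, normSq_apply, latticePt]
  simp
  ring

theorem le_norm_latticePt_sq {τ : ℂ} (hτ : 0 < τ.im) :
    ∃ ε > 0, ∀ p : ℤ × ℤ, ε * ((p.1 : ℝ) ^ 2 + (p.2 : ℝ) ^ 2) ≤ ‖latticePt τ p‖ ^ 2 := by
  have hY : 0 < τ.im ^ 2 := by positivity
  refine ⟨τ.im ^ 2 / (1 + 2 * τ.im ^ 2 + 2 * τ.re ^ 2), by positivity, fun p => ?_⟩
  rw [norm_latticePt_sq, div_mul_eq_mul_div, div_le_iff₀ (by positivity)]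
  generalize (p.1 : ℝ) = a
  generalize (p.2 : ℝ) = b
  generalize τ.re = x at *
  generalize τ.im = y at *
  nlinarith [sq_nonneg (b + 2 * a * x), mul_nonneg hY.le (sq_nonneg (b + 2 * a * x)),
    sq_nonneg (x * (a * x + b)), sq_nonneg (a * x + b), sq_nonneg (a * y ^ 2)]

theorem summable_exp_neg_mul_int_sq {δ : ℝ} (hδ : 0 < δ) :
    Summable fun n : ℤ => Real.exp (-δ * (n : ℝ) ^ 2) := by
  have h := summable_pow_mul_jacobiTheta₂_term_bound 0 (T := δ / Real.pi) (by positivity) 0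
  refine h.congr fun n => ?_
  rw [pow_zero, one_mul]
  congr 1
  field_simp [Real.pi_ne_zero]
  ring

theorem summable_exp_neg_mul_norm_latticePt_sq {τ : ℂ} (hτ : 0 < τ.im) {δ : ℝ} (hδ : 0 < δ) :
    Summable fun p : ℤ × ℤ => Real.exp (-δ * ‖latticePt τ p‖ ^ 2) := by
  obtain ⟨ε, hε, h⟩ := le_norm_latticePt_sq hτ
  have h1 := summable_exp_neg_mul_int_sq (mul_pos hδ hε)
  refine Summable.of_nonneg_of_le (fun _ => (Real.exp_pos _).le) (fun p => ?_)
    (h1.mul_of_nonneg h1 (fun _ => (Real.exp_pos _).le) fun _ => (Real.exp_pos _).le)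
  rw [← Real.exp_add, Real.exp_le_exp]
  nlinarith [mul_le_mul_of_nonneg_left (h p) hδ.le]

theorem eventually_one_le_norm_add_latticePt {τ : ℂ} (hτ : 0 < τ.im) (u : ℂ) :
    ∀ᶠ p : ℤ × ℤ in Filter.cofinite, 1 ≤ ‖u + latticePt τ p‖ := by
  have h := (summable_exp_neg_mul_norm_latticePt_sq hτ one_pos).tendsto_cofinite_zero
  filter_upwards [h.eventually_lt_const (Real.exp_pos (-1 * (1 + ‖u‖) ^ 2))] with p hp
  rw [Real.exp_lt_exp] at hp
  have h1 : 1 + ‖u‖ < ‖latticePt τ p‖ :=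
    lt_of_pow_lt_pow_left₀ 2 (norm_nonneg _) (by linarith)
  have h2 := norm_sub_le (u + latticePt τ p) u
  rw [add_sub_cancel_left] at h2
  linarith

/-- The `l`-dependent real part is `‖l‖² + 2 Re(conj l · (w + c))`; the bound is `‖l + 2(w + c)‖² ≥
0`. -/
theorem re_latticeForm_ge (w c l : ℂ) :
    1 / 2 * ‖l‖ ^ 2 + ((2 * (starRingEnd ℂ) c * w + w ^ 2 - c ^ 2 + 2 * c * (starRingEnd ℂ) c).re -
      2 * ‖w + c‖ ^ 2) ≤ (latticeForm w c l).re := by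
  have e : (latticeForm w c l).re = (2 * (starRingEnd ℂ) c * w + w ^ 2 - c ^ 2 +
      2 * c * (starRingEnd ℂ) c).re + (l.re ^ 2 + l.im ^ 2 + 2 * (l.re * (w.re + c.re) +
        l.im * (w.im + c.im))) := by
    simp [latticeForm, pow_two]
    ring
  rw [e, ← normSq_eq_norm_sq, ← normSq_eq_norm_sq, normSq_apply, normSq_apply,
    add_re w c, add_im w c]
  nlinarith [sq_nonneg (l.re + 2 * (w.re + c.re)), sq_nonneg (l.im + 2 * (w.im + c.im))]

theorem summable_latticeTerm {m : ℕ} (hm : 0 < m) {τ : ℂ} (hτ : 0 < τ.im) (w c : ℂ) :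
    Summable (latticeTerm m τ w c) := by
  have hm' : (0 : ℝ) < m := by exact_mod_cast hm
  have hκ : 0 < Real.pi * m / τ.im := by positivity
  refine summable_div_of_summable_norm_cofinite ?_ (eventually_one_le_norm_add_latticePt hτ (w + c))
  refine Summable.of_norm_bounded ((summable_exp_neg_mul_norm_latticePt_sq hτ
    (half_pos hκ)).mul_left (Real.exp (-(Real.pi * m / τ.im) * ((2 * (starRingEnd ℂ) c * w + w ^ 2 -
      c ^ 2 + 2 * c * (starRingEnd ℂ) c).re - 2 * ‖w + c‖ ^ 2)))) fun p => ?_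
  have e : (-(Real.pi * m / τ.im) * latticeForm w c (latticePt τ p) : ℂ).re =
      -(Real.pi * m / τ.im) * (latticeForm w c (latticePt τ p)).re := by
    rw [← re_ofReal_mul]
    push_cast
    rfl
  rw [norm_exp, e, ← Real.exp_add, Real.exp_le_exp]
  nlinarith [mul_le_mul_of_nonneg_left (re_latticeForm_ge w c (latticePt τ p)) hκ.le]

/-! ### The correction term as a double series -/

theorem tsum_int_eq_sum_residues {g : ℤ → ℂ} (hg : Summable g) (N : ℕ) [NeZero N] :
    ∑' n, g n = ∑ i ∈ Finset.range N, ∑' l : ℤ, g (i + N * l) := by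
  have hs := (Int.divModEquiv N).symm.summable_iff.2 hg
  rw [← (Int.divModEquiv N).symm.tsum_eq]
  have h := hs.tsum_prod
  rw [Finset.sum_range]
  refine h.trans ?_
  simp_rw [tsum_fintype]
  refine (Summable.tsum_finsetSum fun i _ => hs.comp_injective (i := fun l : ℤ => (l, i))
    fun a b h => (Prod.ext_iff.1 h).1).trans ?_
  refine Finset.sum_congr rfl fun i _ => tsum_congr fun l => ?_
  change g (l * N + ((i : ℕ) : ℤ)) = _
  rw [add_comm, mul_comm]

/-- For `0 ≤ i < 2m` both sides are positive exactly when `l ≥ 0`; the offset `-1/2` puts `l = -1`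
on the negative side. -/
theorem sign_eq_sgnZ {m i : ℕ} (hi : i < 2 * m) (l : ℤ) :
    Real.sign ((0 + i : ℝ) + 2 * m * l - 1 / 2 - (0 + i) + 2 * m) = sgnZ (i + (2 * m : ℕ) * l) := by
  have hm : (1 : ℝ) ≤ m := by exact_mod_cast (by omega : 1 ≤ m)
  rcases le_or_gt 0 l with hl | hl
  · have hl' : (0 : ℝ) ≤ l := by exact_mod_cast hl
    rw [sgnZ, if_pos (by positivity), Real.sign_of_pos]
    nlinarith
  · have hl' : (l : ℝ) ≤ -1 := by exact_mod_cast (by omega : l ≤ -1)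
    rw [sgnZ, if_neg, Real.sign_of_neg]
    · nlinarith
    · push_cast
      nlinarith [(by exact_mod_cast hi : (i : ℤ) < 2 * m)]

section Completion
variable {m : ℕ} {τ : ℂ}

/-- The `n`-th summand of the completed geometric series. -/
noncomputable def errTerm (m : ℕ) (τ c : ℂ) (n : ℤ) : ℝ :=
  sgnZ n - errE ((n - 2 * m * (c.im / τ.im)) * Real.sqrt (τ.im / m))

/-- The summands of `zwegersR`, indexed by all integers. -/
noncomputable def zwegersTerm (m : ℕ) (τ c : ℂ) (n : ℤ) : ℂ :=
  errTerm m τ c n * exp (-(Real.pi * I * (n : ℂ) ^ 2 * τ / (2 * m)) + 2 * Real.pi * I * n * c)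

/-- The summands of `jacobiTheta`, indexed by all integers. -/
noncomputable def thetaTerm (m : ℕ) (τ w : ℂ) (n : ℤ) : ℂ :=
  exp (2 * Real.pi * I * n * w + Real.pi * I * (n : ℂ) ^ 2 * τ / (2 * m))

/-- The weight of the `j`-th summand of `Phi1`. -/
noncomputable def phiWeight (m : ℕ) (τ w : ℂ) (j : ℤ) : ℂ :=
  exp (2 * Real.pi * I * m * j * (2 * w)) * exp (2 * Real.pi * I * τ * (m * (j : ℂ) ^ 2))

theorem summable_zwegersTerm (hm : 0 < m) (hτ : 0 < τ.im) (c : ℂ) :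
    Summable (zwegersTerm m τ c) := by
  have hm' : (0 : ℝ) < m := by exact_mod_cast hm
  have hs : 0 < Real.sqrt (τ.im / m) := by positivity
  refine (summable_sgnZ_sub_errE_mul_exp hs (2 * m * (c.im / τ.im)) c (-τ / (2 * m : ℝ)) ?_).congr
    fun n => ?_
  · rw [div_ofReal_im, neg_im, Real.sq_sqrt (by positivity)]
    have : 0 < τ.im / (2 * m) := by positivity
    have e : -τ.im / (2 * m) + τ.im / m = τ.im / (2 * m) := by field_simp; ring
    rwa [e]
  · rw [zwegersTerm, errTerm]
    congr 2
    push_cast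
    ring

theorem summable_thetaTerm (hm : 0 < m) (hτ : 0 < τ.im) (w : ℂ) : Summable (thetaTerm m τ w) := by
  have hm' : (0 : ℝ) < m := by exact_mod_cast hm
  refine (summable_jacobiTheta₂_term (z := w) (τ := τ / (2 * m : ℝ)) ?_).congr fun n => ?_
  · rw [div_ofReal_im]; positivity
  · rw [thetaTerm, jacobiTheta₂_term]
    congr 1
    push_cast
    ring

/-- The terms quadratic in `n` cancel, leaving a geometric series in `n` with the same weight as the
`j`-th term of `Phi1`. -/
theorem zwegersTerm_mul_thetaTerm (hm : 0 < m) (c w : ℂ) (n j : ℤ) :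
    zwegersTerm m τ c n * thetaTerm m τ w (n + 2 * m * j) =
      phiWeight m τ w j * (errTerm m τ c n * exp (2 * Real.pi * I * n * (w + c + j * τ))) := by
  have hm' : (m : ℂ) ≠ 0 := by exact_mod_cast hm.ne'
  rw [zwegersTerm, thetaTerm, phiWeight, mul_assoc, ← exp_add, ← exp_add, mul_left_comm, ← exp_add]
  congr 2
  push_cast
  field_simp
  ring

theorem summable_zwegersTerm_mul_thetaTerm (hm : 0 < m) (hτ : 0 < τ.im) (c w : ℂ) :
    Summable fun p : ℤ × ℤ => zwegersTerm m τ c p.1 * thetaTerm m τ w (p.1 + 2 * m * p.2) := by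
  have h := summable_mul_of_summable_norm (summable_zwegersTerm hm hτ c).norm
    (summable_thetaTerm hm hτ w).norm
  refine h.comp_injective (i := fun p : ℤ × ℤ => (p.1, p.1 + 2 * m * p.2)) fun p q hpq => ?_
  have h1 := (Prod.ext_iff.1 hpq).1
  have h2 := (Prod.ext_iff.1 hpq).2
  simp only at h1 h2
  rw [h1] at h2
  have h3 : (2 * m : ℤ) ≠ 0 := by positivity
  exact Prod.ext h1 (mul_left_cancel₀ h3 (add_left_cancel h2))

theorem zwegersR_eq {i : ℕ} (hi : i < 2 * m) (c : ℂ) :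
    zwegersR (0 + i) m τ c = ∑' l : ℤ, zwegersTerm m τ c (i + (2 * m : ℕ) * l) := by
  refine tsum_congr fun l => ?_
  simp only
  rw [sign_eq_sgnZ hi, zwegersTerm, errTerm]
  push_cast
  simp only [zero_add]

theorem jacobiTheta_eq (hm : 0 < m) (i : ℕ) (w : ℂ) :
    MockTheta.jacobiTheta (0 + i) m τ (2 * w) = ∑' l : ℤ, thetaTerm m τ w (i + 2 * m * l) := by
  have hm' : (m : ℂ) ≠ 0 := by exact_mod_cast hm.ne'
  refine tsum_congr fun l => ?_
  rw [thetaTerm, ← exp_add]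
  congr 1
  push_cast
  field_simp
  ring

theorem jacobiTheta_neg_left (k M : ℝ) (τ z : ℂ) :
    MockTheta.jacobiTheta (-k) M τ z = MockTheta.jacobiTheta k M τ (-z) := by
  unfold MockTheta.jacobiTheta
  rw [← (Equiv.neg ℤ).tsum_eq]
  refine tsum_congr fun l => ?_
  rw [Equiv.neg_apply]
  push_cast
  congr 2 <;> ring

theorem thetaSum_add (m : ℕ) (τ w : ℂ) (n l : ℤ) :
    ∑' j : ℤ, thetaTerm m τ w (n + 2 * m * l + 2 * m * j) =
      ∑' j : ℤ, thetaTerm m τ w (n + 2 * m * j) := by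
  rw [← (Equiv.addLeft l).tsum_eq fun j => thetaTerm m τ w (n + 2 * m * j)]
  refine tsum_congr fun j => ?_
  congr 1
  simp
  ring

/-- The non-holomorphic correction as a double series. -/
theorem sum_zwegersR_mul_jacobiTheta (hm : 0 < m) (hτ : 0 < τ.im) (c w : ℂ) :
    HasSum (fun j : ℤ => phiWeight m τ w j *
        ∑' n : ℤ, errTerm m τ c n * exp (2 * Real.pi * I * n * (w + c + j * τ)))
      (∑ i ∈ Finset.range (2 * m),
        zwegersR (0 + i) m τ c * MockTheta.jacobiTheta (0 + i) m τ (2 * w)) := by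
  have : NeZero (2 * m) := ⟨by omega⟩
  have hs := summable_zwegersTerm_mul_thetaTerm hm hτ c w
  have hs' := (Equiv.prodComm ℤ ℤ).summable_iff.2 hs
  have h1 : ∑' p : ℤ × ℤ, zwegersTerm m τ c p.1 * thetaTerm m τ w (p.1 + 2 * m * p.2) =
      ∑ i ∈ Finset.range (2 * m),
        zwegersR (0 + i) m τ c * MockTheta.jacobiTheta (0 + i) m τ (2 * w) := by
    -- Summing over `j` first gives a theta value depending only on `n` modulo `2m`; summing over
    -- `n` first, below, gives the regularised geometric series.
    rw [hs.tsum_prod, tsum_int_eq_sum_residues hs.prod (2 * m)]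
    refine Finset.sum_congr rfl fun i hi => ?_
    rw [zwegersR_eq (Finset.mem_range.1 hi), jacobiTheta_eq hm, ← tsum_mul_right]
    refine tsum_congr fun l => ?_
    simp only [tsum_mul_left]
    rw [← thetaSum_add m τ w i l]
    push_cast
    rfl
  have h2 := hs'.hasSum.prod_fiberwise fun j => (hs'.prod_factor j).hasSum
  rw [← h1, ← (Equiv.prodComm ℤ ℤ).tsum_eq]
  convert h2 using 2 with j
  · rw [← tsum_mul_left]
    exact tsum_congr fun n => (zwegersTerm_mul_thetaTerm hm c w n j).symm
  · rfl

end Completion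

/-! ### The completed function as a lattice sum -/

theorem conj_eq_sub_two_I_mul_im (z : ℂ) : (starRingEnd ℂ) z = z - 2 * I * z.im := by
  apply Complex.ext
  · simp
  · simp; ring

theorem latticeTerm_eq {m : ℕ} (hm : 0 < m) {τ : ℂ} (hτ : 0 < τ.im) (w c : ℂ) (j b : ℤ) :
    latticeTerm m τ w c (j, b) = phiWeight m τ w j *
      (exp (2 * Real.pi * I * (2 * m * (c.im / τ.im) : ℝ) * (w + c + j * τ + b) -
        Real.pi * (w + c + j * τ + b) ^ 2 / (Real.sqrt (τ.im / m) : ℝ) ^ 2) /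
        (w + c + j * τ + b)) := by
  have hm' : (m : ℂ) ≠ 0 := by exact_mod_cast hm.ne'
  have hY : (τ.im : ℂ) ≠ 0 := ofReal_ne_zero.2 hτ.ne'
  have hs : ((Real.sqrt (τ.im / m) : ℝ) : ℂ) ^ 2 = τ.im / m := by
    rw [← ofReal_pow, Real.sq_sqrt (by positivity)]
    push_cast
    rfl
  rw [hs, latticeTerm, phiWeight, latticePt, ← add_assoc, ← mul_div_assoc, ← exp_add, ← exp_add]
  congr 1
  rw [exp_eq_exp_iff_exists_int]
  -- The cross term of `jτ + b` leaves the discrepancy `2πi·mjb`, invisible to the exponential as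
  -- `m` is an integer.
  refine ⟨m * j * b, ?_⟩
  simp only [latticeForm, map_add, map_mul, conj_eq_sub_two_I_mul_im τ,
    conj_eq_sub_two_I_mul_im c, ← ofReal_intCast, conj_ofReal]
  push_cast
  field_simp
  ring

/-- The `Phi1` part of the completed function as a lattice sum. -/
theorem Phi1_sub_eq_tsum_latticeTerm {m : ℕ} (hm : 0 < m) {τ : ℂ} (hτ : 0 < τ.im) {w c : ℂ}
    (h : ∀ p, w + c + latticePt τ p ≠ 0) :
    Phi1 m 0 τ (w + c) (w - c) 0 -
        1 / 2 * ∑ i ∈ Finset.range (2 * m),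
          zwegersR (0 + i) m τ c * MockTheta.jacobiTheta (0 + i) m τ (2 * w) =
      -1 / (2 * Real.pi * I) * ∑' p, latticeTerm m τ w c p := by
  have hs : 0 < Real.sqrt (τ.im / m) := by positivity
  have hsum := summable_latticeTerm hm hτ w c
  have h1 := hsum.hasSum.prod_fiberwise fun j => (hsum.prod_factor j).hasSum
  have h2 := ((sum_zwegersR_mul_jacobiTheta hm hτ c w).mul_left (1 / 2)).add
    (h1.mul_left (-1 / (2 * Real.pi * I)))
  rw [sub_eq_iff_eq_add', ← h2.tsum_eq, Phi1]
  simp only [mul_zero, neg_zero, exp_zero, one_mul]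
  refine tsum_congr fun j => ?_
  have hu : ∀ b : ℤ, w + c + j * τ + b ≠ 0 := fun b => by
    have := h (j, b)
    rwa [latticePt, ← add_assoc] at this
  have h3 := inv_one_sub_exp_sub_tsum_sgnZ hs hu (2 * m * (c.im / τ.im))
  simp_rw [latticeTerm_eq hm hτ]
  rw [tsum_mul_left, mul_left_comm (-1 / _ : ℂ), ← h3]
  have e1 : phiWeight m τ w j = exp (2 * Real.pi * I * (m : ℝ) * j * (w + c + (w - c)) +
      2 * Real.pi * I * (0 : ℝ) * (w + c)) *
      exp (2 * Real.pi * I * τ * ((m : ℝ) * (j : ℂ) ^ 2 + (0 : ℝ) * j)) := by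
    rw [phiWeight]
    push_cast
    congr 2 <;> ring
  have e2 : exp (2 * Real.pi * I * (w + c)) * exp (2 * Real.pi * I * τ * j) =
      exp (2 * Real.pi * I * (w + c + j * τ)) := by
    rw [← exp_add]
    congr 1
    ring
  rw [← e1, e2]
  simp only [errTerm]
  ring

/-- With `z₁ = w + c`, `z₂ = w - c` this is the substitution `w ↦ -w` with `c` fixed, the source of
the antisymmetrisation. -/
theorem Phi2_eq_Phi1 (M : ℝ) (τ z₁ z₂ t : ℂ) :
    Phi2 M 0 τ z₁ z₂ t = Phi1 M 0 τ (-z₂) (-z₁) t := by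
  unfold Phi1 Phi2
  congr 1
  refine tsum_congr fun j => ?_
  push_cast
  congr 3 <;> ring_nf

theorem PhiTilde_eq_tsum_latticeTerm {m : ℕ} (hm : 0 < m) {τ : ℂ} (hτ : 0 < τ.im) {w c : ℂ}
    (h₁ : ∀ p, w + c + latticePt τ p ≠ 0) (h₂ : ∀ p, -w + c + latticePt τ p ≠ 0) :
    PhiTilde m 0 τ (w + c) (w - c) 0 =
      -1 / (2 * Real.pi * I) * (∑' p, latticeTerm m τ w c p - ∑' p, latticeTerm m τ (-w) c p) := by
  rw [mul_sub, ← Phi1_sub_eq_tsum_latticeTerm hm hτ h₁, ← Phi1_sub_eq_tsum_latticeTerm hm hτ h₂,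
    PhiTilde, Phi, Phi2_eq_Phi1, PhiAdd]
  have e1 : ⌈2 * (m : ℝ)⌉₊ = 2 * m := by
    rw [← Nat.ceil_natCast (R := ℝ) (2 * m)]
    push_cast
    rfl
  have e2 : (w + c - (w - c)) / 2 = c := by ring
  have e3 : w + c + (w - c) = 2 * w := by ring
  have e4 : -(w - c) = -w + c := by ring
  have e5 : -(w + c) = -w - c := by ring
  have e6 : -(2 * w) = 2 * -w := by ring
  rw [e1, e2, e3, e4, e5]
  simp only [jacobiTheta_neg_left, e6, mul_sub, Finset.sum_sub_distrib, mul_zero, neg_zero,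
    exp_zero, mul_one]
  ring

/-! ### Passing to a sublattice of index two -/

/-- The exponent of the exponential in `latticeTerm`. -/
noncomputable def latticeExp (m : ℕ) (τ w c : ℂ) (p : ℤ × ℤ) : ℂ :=
  -(Real.pi * m / τ.im) * latticeForm w c (latticePt τ p)

theorem latticeTerm_eq_mul {m M : ℕ} {τ τ' w w' c c' : ℂ} {p p' : ℤ × ℤ} {μ k : ℂ}
    (hx : w' + c' + latticePt τ' p' = μ * (w + c + latticePt τ p))
    (hX : ∃ n : ℤ, latticeExp m τ' w' c' p' = latticeExp M τ w c p + k + n * (2 * Real.pi * I)) :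
    latticeTerm m τ' w' c' p' = exp k / μ * latticeTerm M τ w c p := by
  obtain ⟨n, hn⟩ := hX
  have h : exp (latticeExp m τ' w' c' p') = exp k * exp (latticeExp M τ w c p) := by
    rw [hn, exp_add, exp_int_mul_two_pi_mul_I, mul_one, exp_add, mul_comm]
  rw [latticeTerm, latticeTerm, hx, ← latticeExp, ← latticeExp, h, div_mul_div_comm]

/-- Two index maps that together enumerate `ℤ × ℤ`. -/
def IsSplitting (e₀ e₁ : ℤ × ℤ → ℤ × ℤ) : Prop := Function.Bijective (Sum.elim e₀ e₁)

theorem IsSplitting.tsum_eq {e₀ e₁ : ℤ × ℤ → ℤ × ℤ} (he : IsSplitting e₀ e₁) {f : ℤ × ℤ → ℂ}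
    (hf : Summable f) : ∑' p, f p = ∑' p, f (e₀ p) + ∑' p, f (e₁ p) := by
  have h₀ : Function.Injective e₀ := he.1.comp Sum.inl_injective
  have h₁ : Function.Injective e₁ := he.1.comp Sum.inr_injective
  rw [← (Equiv.ofBijective _ he).tsum_eq]
  exact Summable.tsum_sum (hf.comp_injective h₀) (hf.comp_injective h₁)

theorem isSplitting_of_forall {e₀ e₁ : ℤ × ℤ → ℤ × ℤ}
    (h₀ : ∀ p q, e₀ p = e₀ q → p = q) (h₁ : ∀ p q, e₁ p = e₁ q → p = q)
    (hd : ∀ p q, e₀ p ≠ e₁ q) (hc : ∀ p, (∃ q, e₀ q = p) ∨ ∃ q, e₁ q = p) :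
    IsSplitting e₀ e₁ := by
  constructor
  · rintro (p | p) (q | q) h
    · exact congrArg _ (h₀ p q h)
    · exact absurd h (hd p q)
    · exact absurd h.symm (hd q p)
    · exact congrArg _ (h₁ p q h)
  · intro p
    rcases hc p with ⟨q, hq⟩ | ⟨q, hq⟩
    · exact ⟨Sum.inl q, hq⟩
    · exact ⟨Sum.inr q, hq⟩

/-- `w` is not a pole of the function of `w` attached to the shift `c`. -/
def IsRegularAt (τ w c : ℂ) : Prop :=
  (∀ p, w + c + latticePt τ p ≠ 0) ∧ ∀ p, -w + c + latticePt τ p ≠ 0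

theorem isRegularAt_of_isRegular {j : ℕ} {τ z : ℂ} (h : IsRegular j τ z) :
    IsRegularAt τ (z / 2) (shift j τ) := by
  constructor <;> rintro ⟨a, b⟩ hp <;> simp only [latticePt] at hp
  · refine (h (-b) (-a)).1 ?_
    push_cast
    linear_combination hp
  · refine (h b a).2 ?_
    linear_combination -hp

/-- The data by which a lattice sum over one half of a lattice is rewritten as a sum over the
sublattice of index two. -/
structure HalfLattice (m : ℕ) (τ' τ w c' c μ : ℂ) (ε : ℤ) (k : ℂ) (e : ℤ × ℤ → ℤ × ℤ) : Prop where
  sq : ε = 1 ∨ ε = -1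
  pt : ∀ p, c' + latticePt τ' (e p) = ε * μ * (c + latticePt τ p)
  exponent : ∀ v, v ^ 2 = w ^ 2 → ∀ p, ∃ n : ℤ, latticeExp m τ' (μ * v) c' (e p) =
    latticeExp (2 * m) τ (ε * v) c p + k + n * (2 * Real.pi * I)

section
variable {m : ℕ} {τ' τ w c' c μ k : ℂ} {ε : ℤ} {e : ℤ × ℤ → ℤ × ℤ}

theorem HalfLattice.add_pt (h : HalfLattice m τ' τ w c' c μ ε k e) (v : ℂ) (p : ℤ × ℤ) :
    μ * v + c' + latticePt τ' (e p) = ε * μ * (ε * v + c + latticePt τ p) := by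
  have h2 : (ε : ℂ) * ε = 1 := by rcases h.sq with h | h <;> rw [h] <;> norm_num
  linear_combination h.pt p - μ * v * h2

theorem HalfLattice.ne_zero (h : HalfLattice m τ' τ w c' c μ ε k e) (hμ : μ ≠ 0)
    (hr : IsRegularAt τ w c) {v : ℂ} (hv : v = w ∨ v = -w) (p : ℤ × ℤ) :
    μ * v + c' + latticePt τ' (e p) ≠ 0 := by
  rw [h.add_pt]
  have hε : (ε : ℂ) ≠ 0 := by rcases h.sq with h | h <;> rw [h] <;> norm_num
  refine mul_ne_zero (mul_ne_zero hε hμ) ?_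
  rcases h.sq with hs | hs <;> rcases hv with rfl | rfl <;> rw [hs] <;>
    simp only [Int.cast_one, Int.cast_neg, one_mul, neg_mul, neg_neg]
  exacts [hr.1 p, hr.2 p, hr.2 p, hr.1 p]

/-- For `ε = -1` the sums at `w` and `-w` are exchanged, and the sign of the denominator
compensates; hence the result is free of `ε`. -/
theorem HalfLattice.tsum_sub (h : HalfLattice m τ' τ w c' c μ ε k e) :
    ∑' p, latticeTerm m τ' (μ * w) c' (e p) - ∑' p, latticeTerm m τ' (μ * -w) c' (e p) =
      exp k / μ * (∑' p, latticeTerm (2 * m) τ w c p - ∑' p, latticeTerm (2 * m) τ (-w) c p) := by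
  have key : ∀ v, v ^ 2 = w ^ 2 → ∑' p, latticeTerm m τ' (μ * v) c' (e p) =
      exp k / (ε * μ) * ∑' p, latticeTerm (2 * m) τ (ε * v) c p := fun v hv => by
    rw [← tsum_mul_left]
    exact tsum_congr fun p => latticeTerm_eq_mul (h.add_pt v p) (h.exponent v hv p)
  rw [key w rfl, key (-w) (neg_sq w)]
  rcases h.sq with h | h <;> rw [h] <;>
    simp only [Int.cast_one, Int.cast_neg, one_mul, neg_mul, neg_neg, div_neg]
  · ring
  · ring

end

/-- The index two decomposition of the completed function. -/
theorem PhiTilde_eq_of_halfLattice {m : ℕ} (hm : 0 < m) {τ' τ w c' c₀ c₁ μ k₀ k₁ : ℂ} {ε₀ ε₁ : ℤ}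
    {e₀ e₁ : ℤ × ℤ → ℤ × ℤ} (hτ' : 0 < τ'.im) (hτ : 0 < τ.im) (hμ : μ ≠ 0)
    (he : IsSplitting e₀ e₁) (h₀ : HalfLattice m τ' τ w c' c₀ μ ε₀ k₀ e₀)
    (h₁ : HalfLattice m τ' τ w c' c₁ μ ε₁ k₁ e₁)
    (hr₀ : IsRegularAt τ w c₀) (hr₁ : IsRegularAt τ w c₁) :
    μ * PhiTilde m 0 τ' (μ * w + c') (μ * w - c') 0 =
      exp k₀ * PhiTilde (2 * m : ℕ) 0 τ (w + c₀) (w - c₀) 0 +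
        exp k₁ * PhiTilde (2 * m : ℕ) 0 τ (w + c₁) (w - c₁) 0 := by
  have hr : ∀ v, v = w ∨ v = -w → ∀ p, μ * v + c' + latticePt τ' p ≠ 0 := by
    intro v hv p
    obtain ⟨q | q, rfl⟩ := he.2 p
    · exact h₀.ne_zero hμ hr₀ hv q
    · exact h₁.ne_zero hμ hr₁ hv q
  have hm2 : 0 < 2 * m := by omega
  rw [PhiTilde_eq_tsum_latticeTerm hm2 hτ hr₀.1 hr₀.2, PhiTilde_eq_tsum_latticeTerm hm2 hτ hr₁.1 hr₁.2,
    PhiTilde_eq_tsum_latticeTerm hm hτ' (hr w (Or.inl rfl))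
      (fun p => by rw [← mul_neg]; exact hr (-w) (Or.inr rfl) p),
    ← mul_neg, he.tsum_eq (summable_latticeTerm hm hτ' _ _),
    he.tsum_eq (summable_latticeTerm hm hτ' _ _)]
  have a := h₀.tsum_sub
  have b := h₁.tsum_sub
  rw [div_mul_eq_mul_div, eq_div_iff hμ] at a b
  linear_combination (-1 / (2 * Real.pi * I)) * (a + b)

/-! ### The index maps of the splittings -/

theorem isSplitting_double_snd (r : ℤ) (hr : r % 2 = 1) :
    IsSplitting (fun p => (p.1, 2 * p.2)) (fun p => (p.1, 2 * p.2 + r)) := by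
  refine isSplitting_of_forall ?_ ?_ ?_ ?_
  · rintro ⟨a, b⟩ ⟨a', b'⟩ h
    simp only [Prod.mk.injEq] at h ⊢
    omega
  · rintro ⟨a, b⟩ ⟨a', b'⟩ h
    simp only [Prod.mk.injEq] at h ⊢
    omega
  · rintro ⟨a, b⟩ ⟨a', b'⟩ h
    simp only [Prod.mk.injEq] at h
    omega
  · rintro ⟨a, b⟩
    rcases Int.emod_two_eq_zero_or_one b with h | h
    · exact Or.inl ⟨(a, b / 2), by simp only [Prod.mk.injEq, true_and]; omega⟩
    · exact Or.inr ⟨(a, (b - r) / 2), by simp only [Prod.mk.injEq, true_and]; omega⟩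

/-- For `τ' = (τ + r)/2` the first map sends `aτ + b` to itself and the second to `-(aτ + b) - τ'`.
-/
theorem isSplitting_double_fst (r : ℤ) :
    IsSplitting (fun p => (2 * p.1, p.2 - r * p.1)) (fun p => (-2 * p.1 - 1, r * p.1 - p.2)) := by
  refine isSplitting_of_forall ?_ ?_ ?_ ?_
  · rintro ⟨a, b⟩ ⟨a', b'⟩ h
    simp only [Prod.mk.injEq] at h ⊢
    obtain rfl : a = a' := by omega
    exact ⟨rfl, by omega⟩
  · rintro ⟨a, b⟩ ⟨a', b'⟩ h
    simp only [Prod.mk.injEq] at h ⊢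
    obtain rfl : a = a' := by omega
    exact ⟨rfl, by omega⟩
  · rintro ⟨a, b⟩ ⟨a', b'⟩ h
    simp only [Prod.mk.injEq] at h
    omega
  · rintro ⟨a, b⟩
    rcases Int.emod_two_eq_zero_or_one a with h | h
    · refine Or.inl ⟨(a / 2, b + r * (a / 2)), ?_⟩
      simp only [Prod.mk.injEq]
      exact ⟨by omega, by ring⟩
    · refine Or.inr ⟨((-a - 1) / 2, r * ((-a - 1) / 2) - b), ?_⟩
      simp only [Prod.mk.injEq]
      exact ⟨by omega, by ring⟩

/-- For `τ' = -1/(2τ) + 1/2` the first map sends `aτ + b` to `-(aτ + b)/τ`, and the second subtracts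
a further `τ'`. -/
theorem isSplitting_swap :
    IsSplitting (fun p => (2 * p.2, -p.1 - p.2)) (fun p => (2 * p.2 - 1, -p.1 - p.2)) := by
  refine isSplitting_of_forall ?_ ?_ ?_ ?_
  · rintro ⟨a, b⟩ ⟨a', b'⟩ h
    simp only [Prod.mk.injEq] at h ⊢
    omega
  · rintro ⟨a, b⟩ ⟨a', b'⟩ h
    simp only [Prod.mk.injEq] at h ⊢
    omega
  · rintro ⟨a, b⟩ ⟨a', b'⟩ h
    simp only [Prod.mk.injEq] at h
    omega
  · rintro ⟨a, b⟩
    rcases Int.emod_two_eq_zero_or_one a with h | h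
    · exact Or.inl ⟨(-b - a / 2, a / 2), by simp only [Prod.mk.injEq]; omega⟩
    · exact Or.inr ⟨(-b - (a + 1) / 2, (a + 1) / 2), by simp only [Prod.mk.injEq]; omega⟩

theorem ATilde_eq_of_halfLattice {m j j₀ j₁ : ℕ} (hm : 0 < m) {τ' τ z z' μ k₀ k₁ : ℂ} {ε₀ ε₁ : ℤ}
    {e₀ e₁ : ℤ × ℤ → ℤ × ℤ} (hτ' : 0 < τ'.im) (hτ : 0 < τ.im) (hμ : μ ≠ 0) (hz : z' = μ * z)
    (he : IsSplitting e₀ e₁)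
    (h₀ : HalfLattice m τ' τ (z / 2) (shift j τ') (shift j₀ τ) μ ε₀ k₀ e₀)
    (h₁ : HalfLattice m τ' τ (z / 2) (shift j τ') (shift j₁ τ) μ ε₁ k₁ e₁)
    (hr₀ : IsRegular j₀ τ z) (hr₁ : IsRegular j₁ τ z) :
    μ * ATilde m j τ' z' = exp k₀ * ATilde (2 * m) j₀ τ z + exp k₁ * ATilde (2 * m) j₁ τ z := by
  have hz2 : z' / 2 = μ * (z / 2) := by rw [hz, mul_div_assoc]
  rw [ATilde, ATilde, ATilde, hz2]
  exact PhiTilde_eq_of_halfLattice hm hτ' hτ hμ he h₀ h₁ (isRegularAt_of_isRegular hr₀)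
    (isRegularAt_of_isRegular hr₁)

/-! ### Exponents and shifts in each case -/

theorem ofReal_im_half (z : ℂ) : ((z / 2).im : ℂ) = z.im / 2 := by
  rw [show (2 : ℂ) = ((2 : ℝ) : ℂ) by norm_num, div_ofReal_im, ofReal_div]

theorem ofReal_im_double (z : ℂ) : ((2 * z).im : ℂ) = 2 * z.im := by
  rw [show (2 : ℂ) = ((2 : ℝ) : ℂ) by norm_num, im_ofReal_mul, ofReal_mul]

theorem halfLattice_double_three_one (m : ℕ) {τ : ℂ} (hτ : 0 < τ.im) (w : ℂ) :
    HalfLattice m (2 * τ) τ w (shift 3 (2 * τ)) (shift 1 τ) 2 1 0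
      (fun p => (p.1, 2 * p.2)) := by
  have hY : (τ.im : ℂ) ≠ 0 := ofReal_ne_zero.2 hτ.ne'
  refine ⟨Or.inl rfl, fun p => ?_, fun v _ p => ⟨0, ?_⟩⟩
  · simp only [shift, latticePt]
    push_cast
    ring
  · simp only [latticeExp, latticeForm, latticePt, shift, map_add, map_mul, map_div₀,
      map_one, map_ofNat, map_intCast, conj_eq_sub_two_I_mul_im τ, ofReal_im_double]
    push_cast
    field_simp
    ring

theorem halfLattice_double_three_two (m : ℕ) {τ : ℂ} (hτ : 0 < τ.im) (w : ℂ) :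
    HalfLattice m (2 * τ) τ w (shift 3 (2 * τ)) (shift 2 τ) 2 1 0
      (fun p => (p.1, 2 * p.2 + (-1))) := by
  have hY : (τ.im : ℂ) ≠ 0 := ofReal_ne_zero.2 hτ.ne'
  refine ⟨Or.inl rfl, fun p => ?_, fun v _ p => ⟨-m * p.1, ?_⟩⟩
  · simp only [shift, latticePt]
    push_cast
    ring
  · simp only [latticeExp, latticeForm, latticePt, shift, map_add, map_sub, map_mul, map_div₀,
      map_one, map_ofNat, map_intCast, conj_eq_sub_two_I_mul_im τ, ofReal_im_double]
    push_cast
    field_simp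
    ring

theorem halfLattice_double_four_four (m : ℕ) {τ : ℂ} (hτ : 0 < τ.im) (w : ℂ) :
    HalfLattice m (2 * τ) τ w (shift 4 (2 * τ)) (shift 4 τ) 2 1 0
      (fun p => (p.1, 2 * p.2)) := by
  have hY : (τ.im : ℂ) ≠ 0 := ofReal_ne_zero.2 hτ.ne'
  refine ⟨Or.inl rfl, fun p => ?_, fun v _ p => ⟨0, ?_⟩⟩
  · simp only [shift, latticePt]
    push_cast
    ring
  · simp only [latticeExp, latticeForm, latticePt, shift, map_add, map_mul, map_div₀,
      map_ofNat, map_intCast, conj_eq_sub_two_I_mul_im τ, ofReal_im_double]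
    push_cast
    field_simp
    ring

theorem halfLattice_double_four_three (m : ℕ) {τ : ℂ} (hτ : 0 < τ.im) (w : ℂ) :
    HalfLattice m (2 * τ) τ w (shift 4 (2 * τ)) (shift 3 τ) 2 1 0
      (fun p => (p.1, 2 * p.2 + 1)) := by
  have hY : (τ.im : ℂ) ≠ 0 := ofReal_ne_zero.2 hτ.ne'
  refine ⟨Or.inl rfl, fun p => ?_, fun v _ p => ⟨m * p.1, ?_⟩⟩
  · simp only [shift, latticePt]
    push_cast
    ring
  · simp only [latticeExp, latticeForm, latticePt, shift, map_add, map_mul, map_div₀,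
      map_one, map_ofNat, map_intCast, conj_eq_sub_two_I_mul_im τ, ofReal_im_double]
    push_cast
    field_simp
    ring

theorem halfLattice_half_six_two (m : ℕ) {τ : ℂ} (hτ : 0 < τ.im) (w : ℂ) :
    HalfLattice m (τ / 2) τ w (shift 6 (τ / 2)) (shift 2 τ) 1 1 0
      (fun p => (2 * p.1, p.2 - 0 * p.1)) := by
  have hY : (τ.im : ℂ) ≠ 0 := ofReal_ne_zero.2 hτ.ne'
  refine ⟨Or.inl rfl, fun p => ?_, fun v _ p => ⟨0, ?_⟩⟩
  · simp only [shift, latticePt]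
    push_cast
    ring
  · simp only [latticeExp, latticeForm, latticePt, shift, map_add, map_sub, map_mul, map_div₀,
      map_one, map_ofNat, map_intCast, conj_eq_sub_two_I_mul_im τ, ofReal_im_half]
    push_cast
    field_simp
    ring

theorem halfLattice_half_six_one (m : ℕ) {τ : ℂ} (hτ : 0 < τ.im) (w : ℂ) :
    HalfLattice m (τ / 2) τ w (shift 6 (τ / 2)) (shift 1 τ) 1 (-1) (-(Real.pi * I * m))
      (fun p => (-2 * p.1 - 1, 0 * p.1 - p.2)) := by
  have hY : (τ.im : ℂ) ≠ 0 := ofReal_ne_zero.2 hτ.ne'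
  refine ⟨Or.inr rfl, fun p => ?_, fun v _ p => ⟨-m * p.2, ?_⟩⟩
  · simp only [shift, latticePt]
    push_cast
    ring
  · simp only [latticeExp, latticeForm, latticePt, shift, map_add, map_sub, map_mul, map_div₀,
      map_one, map_ofNat, map_intCast, conj_eq_sub_two_I_mul_im τ, ofReal_im_half]
    push_cast
    field_simp
    ring

theorem halfLattice_half_five_five (m : ℕ) {τ : ℂ} (hτ : 0 < τ.im) (w : ℂ) :
    HalfLattice m (τ / 2) τ w (shift 5 (τ / 2)) (shift 5 τ) 1 1 0
      (fun p => (2 * p.1, p.2 - 0 * p.1)) := by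
  have hY : (τ.im : ℂ) ≠ 0 := ofReal_ne_zero.2 hτ.ne'
  refine ⟨Or.inl rfl, fun p => ?_, fun v _ p => ⟨0, ?_⟩⟩
  · simp only [shift, latticePt]
    push_cast
    ring
  · simp only [latticeExp, latticeForm, latticePt, shift, map_add, map_mul, map_div₀,
      map_one, map_ofNat, map_intCast, conj_eq_sub_two_I_mul_im τ, ofReal_im_half]
    push_cast
    field_simp
    ring

theorem halfLattice_half_five_six (m : ℕ) {τ : ℂ} (hτ : 0 < τ.im) (w : ℂ) :
    HalfLattice m (τ / 2) τ w (shift 5 (τ / 2)) (shift 6 τ) 1 (-1) (Real.pi * I * m - Real.pi * I * m * τ)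
      (fun p => (-2 * p.1 - 1, 0 * p.1 - p.2)) := by
  have hY : (τ.im : ℂ) ≠ 0 := ofReal_ne_zero.2 hτ.ne'
  refine ⟨Or.inr rfl, fun p => ?_, fun v _ p => ⟨-m * p.2, ?_⟩⟩
  · simp only [shift, latticePt]
    push_cast
    ring
  · simp only [latticeExp, latticeForm, latticePt, shift, map_add, map_sub, map_mul, map_div₀,
      map_one, map_ofNat, map_intCast, conj_eq_sub_two_I_mul_im τ, ofReal_im_half]
    push_cast
    field_simp
    ring

theorem halfLattice_half_add_one_six_four (m : ℕ) {τ : ℂ} (hτ : 0 < τ.im) (w : ℂ) :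
    HalfLattice m ((τ + 1) / 2) τ w (shift 6 ((τ + 1) / 2)) (shift 4 τ) 1 1 0
      (fun p => (2 * p.1, p.2 - 1 * p.1)) := by
  have hY : (τ.im : ℂ) ≠ 0 := ofReal_ne_zero.2 hτ.ne'
  refine ⟨Or.inl rfl, fun p => ?_, fun v _ p => ⟨0, ?_⟩⟩
  · simp only [shift, latticePt]
    push_cast
    ring
  · simp only [latticeExp, latticeForm, latticePt, shift, map_add, map_sub, map_mul, map_div₀,
      map_one, map_ofNat, map_intCast, conj_eq_sub_two_I_mul_im τ, ofReal_im_half, add_im, one_im, add_zero]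
    push_cast
    field_simp
    ring

theorem halfLattice_half_add_one_six_three (m : ℕ) {τ : ℂ} (hτ : 0 < τ.im) (w : ℂ) :
    HalfLattice m ((τ + 1) / 2) τ w (shift 6 ((τ + 1) / 2)) (shift 3 τ) 1 (-1) (-(Real.pi * I * m))
      (fun p => (-2 * p.1 - 1, 1 * p.1 - p.2)) := by
  have hY : (τ.im : ℂ) ≠ 0 := ofReal_ne_zero.2 hτ.ne'
  refine ⟨Or.inr rfl, fun p => ?_, fun v _ p => ⟨m * (p.1 - p.2), ?_⟩⟩
  · simp only [shift, latticePt]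
    push_cast
    ring
  · simp only [latticeExp, latticeForm, latticePt, shift, map_add, map_sub, map_mul, map_div₀,
      map_one, map_ofNat, map_intCast, conj_eq_sub_two_I_mul_im τ, ofReal_im_half, add_im, one_im, add_zero]
    push_cast
    field_simp
    ring

/-- The denominator is `2|τ|²` written without conjugation, so that comparing exponents becomes a
rational identity in `τ` and `Im τ`. -/
theorem inversion_im {τ : ℂ} (hτ : 0 < τ.im) :
    ((-1 / (2 * τ) + 1 / 2).im : ℂ) = τ.im / (2 * τ * (τ - 2 * I * τ.im)) := by
  have h0 : τ ≠ 0 := fun h => by simp [h] at hτ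
  have h1 : (starRingEnd ℂ) τ ≠ 0 := (map_ne_zero _).2 h0
  have h := conj_eq_sub_two_I_mul_im (-1 / (2 * τ) + 1 / 2)
  simp only [map_add, map_div₀, map_neg, map_mul, map_one, map_ofNat] at h
  rw [← conj_eq_sub_two_I_mul_im]
  have h2 := conj_eq_sub_two_I_mul_im τ
  generalize ((-1 / (2 * τ) + 1 / 2).im : ℂ) = y at *
  generalize (starRingEnd ℂ) τ = s at *
  field_simp at h ⊢
  have h3 : 2 * I * (y * 2 * τ * s - τ.im) = 0 := by linear_combination h - h2
  have h4 := (mul_eq_zero.1 h3).resolve_left (by simp)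
  linear_combination h4

theorem halfLattice_inversion_six_five (m : ℕ) {τ : ℂ} (hτ : 0 < τ.im) (z : ℂ) :
    HalfLattice m (-1 / (2 * τ) + 1 / 2) τ (z / 2) (shift 6 (-1 / (2 * τ) + 1 / 2)) (shift 5 τ)
      (1 / τ) (-1) (Real.pi * I * m * z ^ 2 / τ - Real.pi * I * m / (4 * τ))
      (fun p => (2 * p.2, -p.1 - p.2)) := by
  have hY : (τ.im : ℂ) ≠ 0 := ofReal_ne_zero.2 hτ.ne'
  have h0 : τ ≠ 0 := fun h => by simp [h] at hτ
  have h1 : τ - τ.im * 2 * I ≠ 0 := by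
    rw [mul_assoc, mul_comm, ← conj_eq_sub_two_I_mul_im]; exact (map_ne_zero _).2 h0
  refine ⟨Or.inr rfl, fun p => ?_, fun v hv p => ⟨0, ?_⟩⟩
  · simp only [shift, latticePt]
    push_cast
    field_simp
    ring
  · have hz : z ^ 2 = 4 * v ^ 2 := by rw [hv]; ring
    rw [hz]
    simp only [latticeExp, latticeForm, latticePt, shift, map_add, map_sub, map_mul, map_div₀,
      map_neg, map_one, map_ofNat, map_intCast, conj_eq_sub_two_I_mul_im τ, inversion_im hτ]
    push_cast
    field_simp
    ring

theorem halfLattice_inversion_six_six (m : ℕ) {τ : ℂ} (hτ : 0 < τ.im) (z : ℂ) :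
    HalfLattice m (-1 / (2 * τ) + 1 / 2) τ (z / 2) (shift 6 (-1 / (2 * τ) + 1 / 2)) (shift 6 τ)
      (1 / τ) (-1) (Real.pi * I * m * z ^ 2 / τ - Real.pi * I * m / (4 * τ) - Real.pi * I * m * τ)
      (fun p => (2 * p.2 - 1, -p.1 - p.2)) := by
  have hY : (τ.im : ℂ) ≠ 0 := ofReal_ne_zero.2 hτ.ne'
  have h0 : τ ≠ 0 := fun h => by simp [h] at hτ
  have h1 : τ - τ.im * 2 * I ≠ 0 := by
    rw [mul_assoc, mul_comm, ← conj_eq_sub_two_I_mul_im]; exact (map_ne_zero _).2 h0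
  refine ⟨Or.inr rfl, fun p => ?_, fun v hv p => ⟨-m * (p.1 + p.2), ?_⟩⟩
  · simp only [shift, latticePt]
    push_cast
    field_simp
    ring
  · have hz : z ^ 2 = 4 * v ^ 2 := by rw [hv]; ring
    rw [hz]
    simp only [latticeExp, latticeForm, latticePt, shift, map_add, map_sub, map_mul, map_div₀,
      map_neg, map_one, map_ofNat, map_intCast, conj_eq_sub_two_I_mul_im τ, inversion_im hτ]
    push_cast
    field_simp
    ring

end

/-! ### The six identities -/

open Complex MockTheta in
theorem mainTheorem7 (m : ℕ) (hm : 0 < m) (τ z : ℂ) (hτ : 0 < τ.im) :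
    (IsRegular 1 τ z → IsRegular 2 τ z →
      2 * ARing m 3 (2 * τ) (2 * z) = ARing (2 * m) 1 τ z + ARing (2 * m) 2 τ z) ∧
    (IsRegular 1 τ z → IsRegular 2 τ z →
      ARing m 6 (τ / 2) z =
        exp (-(Real.pi * I * m)) * ARing (2 * m) 1 τ z + ARing (2 * m) 2 τ z) ∧
    (IsRegular 3 τ z → IsRegular 4 τ z →
      2 * ARing m 4 (2 * τ) (2 * z) = ARing (2 * m) 3 τ z + ARing (2 * m) 4 τ z) ∧
    (IsRegular 3 τ z → IsRegular 4 τ z →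
      exp (Real.pi * I * m / 4) * ARing m 6 ((τ + 1) / 2) z =
        exp (-(Real.pi * I * m)) * ARing (2 * m) 3 τ z + ARing (2 * m) 4 τ z) ∧
    (IsRegular 5 τ z → IsRegular 6 τ z →
      ARing m 5 (τ / 2) z =
        ARing (2 * m) 5 τ z + exp (Real.pi * I * m) * ARing (2 * m) 6 τ z) ∧
    (IsRegular 5 τ z → IsRegular 6 τ z →
      ARing m 6 (-1 / (2 * τ) + 1 / 2) (z / τ) =
        τ * exp (-(Real.pi * I * m / 4)) * exp (Real.pi * I * m * z ^ 2 / τ) *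
          (ARing (2 * m) 5 τ z + ARing (2 * m) 6 τ z)) := by
  have hd : 0 < (2 * τ).im := by simpa using hτ
  have hh : 0 < (τ / 2).im := by simpa using hτ
  have hh1 : 0 < ((τ + 1) / 2).im := by simpa using hτ
  have h0 : τ ≠ 0 := fun h => by simp [h] at hτ
  have hi : 0 < (-1 / (2 * τ) + 1 / 2).im := by
    have e : (-1 / (2 * τ) + 1 / 2).im = τ.im / (2 * normSq τ) := by
      have : -1 / (2 * τ) + 1 / 2 = (-τ⁻¹ + 1) / 2 := by field_simp
      rw [this, ← ofReal_inj, ofReal_im_half, ← ofReal_one, add_im, neg_im, inv_im, ofReal_im]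
      push_cast
      have : (normSq τ : ℂ) ≠ 0 := ofReal_ne_zero.2 (normSq_pos.2 h0).ne'
      field_simp
      ring
    rw [e]
    have := normSq_pos.2 h0
    positivity
  refine ⟨fun r₁ r₂ => ?_, fun r₁ r₂ => ?_, fun r₃ r₄ => ?_, fun r₃ r₄ => ?_, fun r₅ r₆ => ?_,
    fun r₅ r₆ => ?_⟩ <;> simp only [ARing]
  · have h := ATilde_eq_of_halfLattice hm hd hτ two_ne_zero rfl (isSplitting_double_snd (-1) rfl)
      (halfLattice_double_three_one m hτ _) (halfLattice_double_three_two m hτ _) r₁ r₂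
    have e : (Real.pi * I * (2 * m : ℕ) * τ / 8 : ℂ) = Real.pi * I * m * (2 * τ) / 8 := by
      push_cast; ring
    rw [exp_zero] at h
    rw [e]
    linear_combination exp (-(Real.pi * I * m * (2 * τ) / 8)) * h
  · have h := ATilde_eq_of_halfLattice hm hh hτ one_ne_zero (one_mul z).symm
      (isSplitting_double_fst 0) (halfLattice_half_six_two m hτ _)
      (halfLattice_half_six_one m hτ _) r₂ r₁
    have e : (Real.pi * I * (2 * m : ℕ) * τ / 8 : ℂ) = Real.pi * I * m * (τ / 2) / 2 := by
      push_cast; ring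
    rw [exp_zero] at h
    rw [e]
    linear_combination exp (-(Real.pi * I * m * (τ / 2) / 2)) * h
  · have h := ATilde_eq_of_halfLattice hm hd hτ two_ne_zero rfl (isSplitting_double_snd 1 rfl)
      (halfLattice_double_four_four m hτ _) (halfLattice_double_four_three m hτ _) r₄ r₃
    have e : (Real.pi * I * (2 * m : ℕ) * τ / 8 : ℂ) = Real.pi * I * m * (2 * τ) / 8 := by
      push_cast; ring
    rw [exp_zero] at h
    rw [e]
    linear_combination exp (-(Real.pi * I * m * (2 * τ) / 8)) * h
  · have h := ATilde_eq_of_halfLattice hm hh1 hτ one_ne_zero (one_mul z).symm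
      (isSplitting_double_fst 1) (halfLattice_half_add_one_six_four m hτ _)
      (halfLattice_half_add_one_six_three m hτ _) r₄ r₃
    have e : exp (-(Real.pi * I * (2 * m : ℕ) * τ / 8)) =
        exp (Real.pi * I * m / 4) * exp (-(Real.pi * I * m * ((τ + 1) / 2) / 2)) := by
      rw [← exp_add]
      congr 1
      push_cast
      ring
    rw [exp_zero] at h
    rw [e]
    linear_combination
      exp (Real.pi * I * m / 4) * exp (-(Real.pi * I * m * ((τ + 1) / 2) / 2)) * h
  · have h := ATilde_eq_of_halfLattice hm hh hτ one_ne_zero (one_mul z).symm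
      (isSplitting_double_fst 0) (halfLattice_half_five_five m hτ _)
      (halfLattice_half_five_six m hτ _) r₅ r₆
    have e : exp (Real.pi * I * m - Real.pi * I * m * τ) =
        exp (Real.pi * I * m) * exp (-(Real.pi * I * (2 * m : ℕ) * τ / 2)) := by
      rw [← exp_add]
      congr 1
      push_cast
      ring
    rw [exp_zero, e] at h
    linear_combination h
  · have h := ATilde_eq_of_halfLattice (z' := z / τ) hm hi hτ (one_div_ne_zero h0) (by ring)
      isSplitting_swap (halfLattice_inversion_six_five m hτ z)
      (halfLattice_inversion_six_six m hτ z) r₅ r₆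
    -- The extra `-πimτ` on the second half is exactly the normalising factor of `ARing (2 * m) 6`.
    have e₁ : exp (Real.pi * I * m * z ^ 2 / τ - Real.pi * I * m / (4 * τ) - Real.pi * I * m * τ) =
        exp (Real.pi * I * m * z ^ 2 / τ - Real.pi * I * m / (4 * τ)) *
          exp (-(Real.pi * I * (2 * m : ℕ) * τ / 2)) := by
      rw [← exp_add]
      congr 1
      push_cast
      ring
    have e₂ : exp (-(Real.pi * I * m * (-1 / (2 * τ) + 1 / 2) / 2)) *
        exp (Real.pi * I * m * z ^ 2 / τ - Real.pi * I * m / (4 * τ)) =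
        exp (-(Real.pi * I * m / 4)) * exp (Real.pi * I * m * z ^ 2 / τ) := by
      rw [← exp_add, ← exp_add]
      congr 1
      field_simp
      ring
    rw [e₁, one_div, inv_mul_eq_iff_eq_mul₀ h0] at h
    rw [h, mul_assoc τ, ← e₂]
    ring
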